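/- All systems are finite-dimensional, with $A'\neq 0$, and logarithms are base two. Let $\mathcal N^{A'\to B}$ be a quantum channel (a map $\mathcal N(\rho)=\sum_k A_k\rho A_k^\dagger$ with $\sum_k A_k^\dagger A_k=I$). Let $U^{A'\to BE}$ be any isometric extension of it, i.e. $U^\dagger U=I$ and $\mathrm{Tr}_E\{U\rho U^\dagger\}=\mathcal N(\rho)$; write $U(\rho)=U\rho U^\dagger$. Let $H(A)_\rho=-\mathrm{Tr}\{\rho^A\log_2\rho^A\}$, and let $$I(A;B)_\rho=H(A)_\rho+H(B)_\rho-H(AB)_\rho,$$ $$I(A;B|C)_\rho=H(AC)_\rho+H(BC)_\rho-H(C)_\rho-H(ABC)_\rho,$$ $$I(A\rangle BX)_\rho=H(BX)_\rho-H(ABX)_\rho.$$ For $\mu\ge 0$ define the Devetak–Shor classical-quantum trade-off formula $$f_\mu(\mathcal N)=\max_\rho\; I(X;B)_\rho+I(A\rangle BX)_\rho+\mu\, I(A\rangle BX)_\rho,$$ where the maximum is over all states $\rho^{XAB}=\sum_x p_X(x)\,|x\rangle\langle x|^X\otimes\mathcal N^{A'\to B}(\phi_x^{AA'})$ with a finite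 alphabet for $X$, a finite-dimensional reference system $A$, and pure states $\phi_x^{AA'}$. Define the public-private trade-off formula $$P_\mu(\mathcal N)=\max_\sigma\; I(X;B)_\sigma+I(Y;B|X)_\sigma-I(Y;E|X)_\sigma+\mu\,[\,I(Y;B|X)_\sigma-I(Y;E|X)_\sigma\,],$$ where the maximum is over all states $\sigma^{XYBE}=\sum_{x,y}p_{X,Y}(x,y)\,|x\rangle\langle x|^X\otimes|y\rangle\langle y|^Y\otimes U(\rho_{x,y}^{A'})$ with finite alphabets for $X$ and $Y$ and density operators (mixed states) $\rho_{x,y}^{A'}$. Then both maxima are attained, and $$f_\mu(\mathcal N)\le P_\mu(\mathcal N).$$ If moreover $\mathcal N$ is degradable, i.e. for some isometric extension of $\mathcal N$ with environment $E'$ and complementary channel $\mathcal N^c(\rho)=\mathrm{Tr}_B\{U'\rho U'^\dagger\}$ there is a quantum channel $\mathcal D^{B\to E'}$ with $\mathcal D(\mathcal N(\rho))=\mathcal N^c(\rho)$ for all density operators $\rho$, then $$f_\mu(\mathcal N)=P_\mu(\mathcal N).$$ -/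

import Mathlib

open scoped Matrix Kronecker ComplexOrder

noncomputable section

namespace QTradeoff

/-- Density operators on the finite-dimensional system with orthonormal basis indexed by `S`. -/
def IsDensity {S : Type*} [Fintype S] (ρ : Matrix S S ℂ) : Prop :=
  ρ.PosSemidef ∧ ρ.trace = 1

/-- The operator `|v⟩⟨v|`. -/
def ketbra {S : Type*} (v : S → ℂ) : Matrix S S ℂ := Matrix.vecMulVec v (star v)

/-- Unit vectors, i.e. pure states. -/
def IsUnitVector {S : Type*} [Fintype S] (v : S → ℂ) : Prop := ∑ s, ‖v s‖ ^ 2 = 1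

/-- The von Neumann entropy `-Tr (ρ log₂ ρ)`, with `log₂ ρ` given by the functional calculus
(and `0 log 0 = 0`). -/
def entropy {S : Type*} [Fintype S] [DecidableEq S] (ρ : Matrix S S ℂ) : ℝ :=
  -(ρ * cfc (Real.logb 2) ρ).trace.re

/-- The partial trace over `T`, where `f` identifies `K × T` with the index set `S` of the whole
system. -/
def partialTrace {S K T : Type*} [Fintype T] (f : K → T → S) (M : Matrix S S ℂ) : Matrix K K ℂ :=
  Matrix.of fun i j => ∑ t, M (f i t) (f j t)

/-- The quantum mutual information `I(P;Q) = H(P) + H(Q) - H(PQ)`. -/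
def mutualInfo {P Q : Type*} [Fintype P] [DecidableEq P] [Fintype Q] [DecidableEq Q]
    (ρ : Matrix (P × Q) (P × Q) ℂ) : ℝ :=
  entropy (partialTrace (fun (p : P) (q : Q) => (p, q)) ρ)
    + entropy (partialTrace (fun (q : Q) (p : P) => (p, q)) ρ)
    - entropy ρ

/-- The conditional quantum mutual information of a state on `P ⊗ Q ⊗ R`, conditioned on the
first factor: `I(Q;R|P) = H(PQ) + H(PR) - H(P) - H(PQR)`. -/
def condMutualInfo {P Q R : Type*} [Fintype P] [DecidableEq P] [Fintype Q] [DecidableEq Q]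
    [Fintype R] [DecidableEq R] (ρ : Matrix (P × Q × R) (P × Q × R) ℂ) : ℝ :=
  entropy (partialTrace (fun (pq : P × Q) (r : R) => (pq.1, pq.2, r)) ρ)
    + entropy (partialTrace (fun (pr : P × R) (q : Q) => (pr.1, q, pr.2)) ρ)
    - entropy (partialTrace (fun (p : P) (qr : Q × R) => (p, qr.1, qr.2)) ρ)
    - entropy ρ

/-- The coherent information of a state on `P ⊗ Q ⊗ R`, from the middle factor to the other two:
`I(Q⟩RP) = H(RP) - H(QRP)`. -/
def coherentInfo {P Q R : Type*} [Fintype P] [DecidableEq P] [Fintype Q] [DecidableEq Q]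
    [Fintype R] [DecidableEq R] (ρ : Matrix (P × Q × R) (P × Q × R) ℂ) : ℝ :=
  entropy (partialTrace (fun (pr : P × R) (q : Q) => (pr.1, q, pr.2)) ρ) - entropy ρ

/-- Quantum channels (completely positive trace-preserving maps), through a Kraus form. -/
def IsQuantumChannel {A B : Type*} [Fintype A] [DecidableEq A] [Fintype B]
    (N : Matrix A A ℂ →ₗ[ℂ] Matrix B B ℂ) : Prop :=
  ∃ (k : ℕ) (K : Fin k → Matrix B A ℂ),
    ∑ l, (K l)ᴴ * K l = 1 ∧ ∀ ρ, N ρ = ∑ l, K l * ρ * (K l)ᴴ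

/-- The map `id ⊗ N` on operators of `R ⊗ A`. -/
def idTensor {R A B : Type*} (N : Matrix A A ℂ →ₗ[ℂ] Matrix B B ℂ)
    (M : Matrix (R × A) (R × A) ℂ) : Matrix (R × B) (R × B) ℂ :=
  Matrix.of fun i j => N (Matrix.of fun a a' => M (i.1, a) (j.1, a')) i.2 j.2

/-- `V : A → B ⊗ E` is an isometric extension of `N`, with environment `E`. -/
def IsIsometricExtension {A B E : Type*} [Fintype A] [DecidableEq A] [Fintype B] [Fintype E]
    (N : Matrix A A ℂ →ₗ[ℂ] Matrix B B ℂ) (V : Matrix (B × E) A ℂ) : Prop :=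
  Vᴴ * V = 1 ∧
    ∀ ρ, partialTrace (fun (b : B) (e : E) => (b, e)) (V * ρ * Vᴴ) = N ρ

/-- The complementary channel of the isometric extension `V`, applied to `ρ`. -/
def complementary {A B E : Type*} [Fintype A] [Fintype B]
    (V : Matrix (B × E) A ℂ) (ρ : Matrix A A ℂ) : Matrix E E ℂ :=
  partialTrace (fun (e : E) (b : B) => (b, e)) (V * ρ * Vᴴ)

/-- `N` is degradable: composing `N` with some channel from the output to the environment of an
isometric extension gives the complementary channel. -/
def IsDegradable {A B : Type*} [Fintype A] [DecidableEq A] [Fintype B] [DecidableEq B]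
    (N : Matrix A A ℂ →ₗ[ℂ] Matrix B B ℂ) : Prop :=
  ∃ (d : ℕ) (V : Matrix (B × Fin d) A ℂ) (D : Matrix B B ℂ →ₗ[ℂ] Matrix (Fin d) (Fin d) ℂ),
    IsIsometricExtension N V ∧ IsQuantumChannel D ∧
      ∀ ρ, IsDensity ρ → D (N ρ) = complementary V ρ

/-- The state `∑ₓ p(x) |x⟩⟨x| ⊗ (id ⊗ N)(φₓ)` on `X ⊗ R ⊗ B`. -/
def cqState {X R A B : Type*} [Fintype X] [DecidableEq X]
    (N : Matrix A A ℂ →ₗ[ℂ] Matrix B B ℂ) (p : X → ℝ) (φ : X → R × A → ℂ) :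
    Matrix (X × R × B) (X × R × B) ℂ :=
  ∑ x, (p x : ℂ) • (Matrix.single x x 1 ⊗ₖ idTensor N (ketbra (φ x)))

/-- The state `∑ₓᵧ p(x,y) |x⟩⟨x| ⊗ |y⟩⟨y| ⊗ V ρₓᵧ V†` on `X ⊗ Y ⊗ B ⊗ E`. -/
def ppState {X Y A B E : Type*} [Fintype X] [DecidableEq X] [Fintype Y] [DecidableEq Y]
    [Fintype A] (V : Matrix (B × E) A ℂ) (p : X × Y → ℝ) (ρ : X → Y → Matrix A A ℂ) :
    Matrix (X × Y × B × E) (X × Y × B × E) ℂ :=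
  ∑ x, ∑ y, (p (x, y) : ℂ) •
    (Matrix.single x x 1 ⊗ₖ (Matrix.single y y 1 ⊗ₖ (V * ρ x y * Vᴴ)))

/-- `I(X;B) + I(R⟩BX) + μ I(R⟩BX)` for a state on `X ⊗ R ⊗ B`. -/
def cqObjective {X R B : Type*} [Fintype X] [DecidableEq X] [Fintype R] [DecidableEq R]
    [Fintype B] [DecidableEq B] (μ : ℝ) (ρ : Matrix (X × R × B) (X × R × B) ℂ) : ℝ :=
  mutualInfo (partialTrace (fun (xb : X × B) (r : R) => (xb.1, r, xb.2)) ρ)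
    + coherentInfo ρ + μ * coherentInfo ρ

/-- `I(X;B) + I(Y;B|X) - I(Y;E|X) + μ [I(Y;B|X) - I(Y;E|X)]` for a state on `X ⊗ Y ⊗ B ⊗ E`. -/
def ppObjective {X Y B E : Type*} [Fintype X] [DecidableEq X] [Fintype Y] [DecidableEq Y]
    [Fintype B] [DecidableEq B] [Fintype E] [DecidableEq E] (μ : ℝ)
    (σ : Matrix (X × Y × B × E) (X × Y × B × E) ℂ) : ℝ :=
  let σXB := partialTrace (fun (xb : X × B) (ye : Y × E) => (xb.1, ye.1, xb.2, ye.2)) σ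
  let σXYB := partialTrace (fun (s : X × Y × B) (e : E) => (s.1, s.2.1, s.2.2, e)) σ
  let σXYE := partialTrace (fun (s : X × Y × E) (b : B) => (s.1, s.2.1, b, s.2.2)) σ
  mutualInfo σXB + condMutualInfo σXYB - condMutualInfo σXYE
    + μ * (condMutualInfo σXYB - condMutualInfo σXYE)

/-- The values over which the classical-quantum trade-off formula maximizes: finite alphabets and
reference systems of any size, pure input states. -/
def cqValues {A B : Type*} [Fintype A] [Fintype B] [DecidableEq B]
    (μ : ℝ) (N : Matrix A A ℂ →ₗ[ℂ] Matrix B B ℂ) : Set ℝ :=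
  {r | ∃ (m d : ℕ) (p : Fin m → ℝ) (φ : Fin m → Fin d × A → ℂ),
    p ∈ stdSimplex ℝ (Fin m) ∧ (∀ x, IsUnitVector (φ x)) ∧ r = cqObjective μ (cqState N p φ)}

/-- The values over which the public-private trade-off formula maximizes: finite alphabets of any
size, mixed input states. -/
def ppValues {A B E : Type*} [Fintype A] [Fintype B] [DecidableEq B] [Fintype E] [DecidableEq E]
    (μ : ℝ) (V : Matrix (B × E) A ℂ) : Set ℝ :=
  {r | ∃ (m n : ℕ) (p : Fin m × Fin n → ℝ) (ρ : Fin m → Fin n → Matrix A A ℂ),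
    p ∈ stdSimplex ℝ (Fin m × Fin n) ∧ (∀ x y, IsDensity (ρ x y)) ∧
      r = ppObjective μ (ppState V p ρ)}

/-- The Devetak–Shor classical-quantum trade-off formula. -/
def cqFormula {A B : Type*} [Fintype A] [Fintype B] [DecidableEq B]
    (μ : ℝ) (N : Matrix A A ℂ →ₗ[ℂ] Matrix B B ℂ) : ℝ :=
  sSup (cqValues μ N)

/-- The public-private trade-off formula, of the channel with isometric extension `V`. -/
def ppFormula {A B E : Type*} [Fintype A] [Fintype B] [DecidableEq B] [Fintype E] [DecidableEq E]
    (μ : ℝ) (V : Matrix (B × E) A ℂ) : ℝ :=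
  sSup (ppValues μ V)

end QTradeoff

end

/-! Write `Nᶜ` for the complementary channel and `I_c(ρ) = H(N ρ) - H(Nᶜ ρ)`. For a pure input with
reduced state `ρ`, the output on `R ⊗ B` has the entropy of `Nᶜ ρ`, so the classical-quantum
objective is `H(N ρ̄) + ∑ p(x) cqTerm(ρ_x)` with `cqTerm = μ H(N ·) - (1 + μ) H(Nᶜ ·)` and `ρ̄` the
mean input. The public-private objective has the same form, with `ρ_x` a mixture of the `ρ_{x,y}`
and the extra summand `-(1 + μ) ∑ q(y|x) I_c(ρ_{x,y})`.

Hence both value sets are images, under `(ρ, t) ↦ H(N ρ) + t`, of convex hulls of compact sets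
(`cqValues_eq`, `ppValues_eq`). Carathéodory's theorem bounds the alphabets, and continuity of
entropy gives attainment. Pure states have `I_c = 0`, so spectral decomposition of each `ρ_x` makes
every classical-quantum value a public-private one.

For degradable `N`, `I_c ≥ 0` everywhere, so dropping the extra summand can only raise the value.
Indeed, for a pure-state ensemble of `ρ`, `I_c(ρ)` is the Holevo quantity at `B` minus that at the
environment, and `holevo_mono` applies to the degrading map. It rests on `relativeEntropy_mono`,
proved by differentiating a regularised `Tr (ρ log σ)` in a parameter `s`: the derivative is `⟨ρ,
(L_σ + s R_ρ)⁻¹ ρ⟩`, whose variational form decreases under channels by a Schwarz inequality. -/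

noncomputable section

namespace QTradeoff

open Polynomial Matrix

set_option linter.unusedSectionVars false

/-! ### Entropy as a spectral invariant. -/

section Entropy

variable {S T : Type*} [Fintype S] [DecidableEq S] [Fintype T] [DecidableEq T]

/-- The function `-x log₂ x`. -/
def entropyTerm (x : ℝ) : ℝ := Real.negMulLog x / Real.log 2

theorem neg_mul_logb_eq (x : ℝ) : -(x * Real.logb 2 x) = entropyTerm x := by
  simp only [entropyTerm, Real.negMulLog, Real.logb]
  ring

@[simp] theorem entropyTerm_zero : entropyTerm 0 = 0 := by simp [entropyTerm]

theorem entropyTerm_mul (x y : ℝ) :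
    entropyTerm (x * y) = y * entropyTerm x + x * entropyTerm y := by
  simp only [entropyTerm, Real.negMulLog_mul]
  ring

theorem continuous_entropyTerm : Continuous entropyTerm :=
  Real.continuous_negMulLog.div_const _

theorem entropy_eq_sum_eigenvalues {M : Matrix S S ℂ} (hM : M.IsHermitian) :
    entropy M = ∑ i, entropyTerm (hM.eigenvalues i) := by
  have h : M * cfc (Real.logb 2) M = Unitary.conjStarAlgAut ℂ _ hM.eigenvectorUnitary
      (diagonal fun i => ((hM.eigenvalues i * Real.logb 2 (hM.eigenvalues i) : ℝ) : ℂ)) := by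
    rw [hM.cfc_eq, Matrix.IsHermitian.cfc]
    nth_rewrite 1 [hM.spectral_theorem]
    rw [← map_mul, diagonal_mul_diagonal]
    simp
  rw [entropy, h, Unitary.conjStarAlgAut_apply, trace_mul_cycle, Unitary.coe_star_mul_self, one_mul,
    trace_diagonal, Complex.re_sum, ← Finset.sum_neg_distrib]
  exact Finset.sum_congr rfl fun i _ => by rw [Complex.ofReal_re, neg_mul_logb_eq]

theorem entropy_eq_sum_roots {M : Matrix S S ℂ} (hM : M.IsHermitian) :
    entropy M = (M.charpoly.roots.map fun z => entropyTerm z.re).sum := by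
  rw [entropy_eq_sum_eigenvalues hM, hM.roots_charpoly_eq_eigenvalues]
  simp

/-- Zero eigenvalues contribute nothing, so powers of `X` are harmless; this permits comparison
across different dimensions. -/
theorem entropy_eq_of_charpoly {M : Matrix S S ℂ} {M' : Matrix T T ℂ} (hM : M.IsHermitian)
    (hM' : M'.IsHermitian) (a b : ℕ) (h : X ^ a * M.charpoly = X ^ b * M'.charpoly) :
    entropy M = entropy M' := by
  rw [entropy_eq_sum_roots hM, entropy_eq_sum_roots hM']
  have h1 := congrArg (fun p : ℂ[X] => (p.roots.map fun z => entropyTerm z.re).sum) h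
  simpa [roots_mul, M.charpoly_monic.ne_zero, M'.charpoly_monic.ne_zero, Multiset.map_nsmul,
    Multiset.sum_nsmul] using h1

/-- The Schmidt decomposition in entropic form: up to a transpose, these are the two marginals of
the pure state with coefficient matrix `M`. -/
theorem entropy_mul_conjTranspose (M : Matrix S T ℂ) : entropy (M * Mᴴ) = entropy (Mᴴ * M) :=
  entropy_eq_of_charpoly (isHermitian_mul_conjTranspose_self M)
    (isHermitian_conjTranspose_mul_self M) _ _ (charpoly_mul_comm' M Mᴴ)

theorem entropy_transpose {M : Matrix S S ℂ} (hM : M.IsHermitian) : entropy Mᵀ = entropy M :=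
  entropy_eq_of_charpoly hM.transpose hM 0 0 (by rw [charpoly_transpose])

theorem entropy_submatrix {M : Matrix S S ℂ} (hM : M.IsHermitian) (e : T ≃ S) :
    entropy (M.submatrix e e) = entropy M :=
  entropy_eq_of_charpoly (hM.submatrix e) hM 0 0 (by
    rw [← charpoly_reindex e.symm M, reindex_apply, Equiv.symm_symm])

theorem entropy_diagonal (p : S → ℝ) :
    entropy (diagonal fun s => (p s : ℂ)) = ∑ s, entropyTerm (p s) := by
  rw [entropy_eq_sum_roots (isHermitian_diagonal_of_self_adjoint _ (by ext; simp)),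
    charpoly_diagonal, roots_prod _ _ (Finset.prod_ne_zero_iff.2 fun i _ => X_sub_C_ne_zero _)]
  simp

theorem entropy_smul {M : Matrix S S ℂ} (hM : M.IsHermitian) (p : ℝ) :
    entropy ((p : ℂ) • M) = p * entropy M + M.trace.re * entropyTerm p := by
  have hp : ((p : ℂ) • M).charpoly = ∏ i, (X - C ((p * hM.eigenvalues i : ℝ) : ℂ)) := by
    conv_lhs => rw [hM.spectral_theorem, ← map_smul, Unitary.conjStarAlgAut_apply,
      charpoly_mul_comm, ← mul_assoc, Unitary.coe_star_mul_self, one_mul, ← diagonal_smul,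
      charpoly_diagonal]
    simp
  have hpM : ((p : ℂ) • M).IsHermitian := by
    rw [IsHermitian, conjTranspose_smul, hM.eq]; simp
  rw [entropy_eq_sum_roots hpM, hp,
    roots_prod _ _ (Finset.prod_ne_zero_iff.2 fun i _ => X_sub_C_ne_zero _),
    entropy_eq_sum_eigenvalues hM, hM.trace_eq_sum_eigenvalues]
  simp only [roots_X_sub_C, Multiset.map_bind, Multiset.map_singleton, Multiset.sum_bind,
    Multiset.sum_singleton, Complex.ofReal_re, entropyTerm_mul, Complex.coe_algebraMap,
    Complex.re_sum]
  rw [Finset.mul_sum, Finset.sum_mul, ← Finset.sum_add_distrib, Finset.sum]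
  simp [add_comm]

/-- The block-diagonal operator `∑ₓ |x⟩⟨x| ⊗ Mₓ`. -/
def cqBlock {X S : Type*} [DecidableEq X] (M : X → Matrix S S ℂ) : Matrix (X × S) (X × S) ℂ :=
  Matrix.of fun i j => if i.1 = j.1 then M i.1 i.2 j.2 else 0

variable {X : Type*} [Fintype X] [DecidableEq X]

theorem cqBlock_eq_submatrix (M : X → Matrix S S ℂ) :
    cqBlock M = (blockDiagonal M).submatrix (Equiv.prodComm X S) (Equiv.prodComm X S) := by
  ext ⟨x, s⟩ ⟨y, t⟩
  simp [cqBlock, blockDiagonal_apply]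

theorem isHermitian_cqBlock {M : X → Matrix S S ℂ} (hM : ∀ x, (M x).IsHermitian) :
    (cqBlock M).IsHermitian := by
  rw [cqBlock_eq_submatrix]
  refine IsHermitian.submatrix ?_ _
  rw [IsHermitian, blockDiagonal_conjTranspose]
  congr
  exact funext hM

theorem charpoly_blockDiagonal (M : X → Matrix S S ℂ) :
    (blockDiagonal M).charpoly = ∏ x, (M x).charpoly := by
  simp only [Matrix.charpoly]
  rw [← det_blockDiagonal]
  congr 1
  ext ⟨s, x⟩ ⟨t, y⟩ : 2
  simp only [charmatrix_apply, blockDiagonal_apply, diagonal_apply, Prod.mk.injEq]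
  by_cases hx : x = y <;> simp [hx]

theorem entropy_cqBlock {M : X → Matrix S S ℂ} (hM : ∀ x, (M x).IsHermitian) :
    entropy (cqBlock M) = ∑ x, entropy (M x) := by
  rw [entropy_eq_sum_roots (isHermitian_cqBlock hM), cqBlock_eq_submatrix]
  have h := charpoly_reindex (Equiv.prodComm X S).symm (blockDiagonal M)
  rw [reindex_apply, Equiv.symm_symm] at h
  rw [h, charpoly_blockDiagonal, roots_prod _ _
    (Finset.prod_ne_zero_iff.2 fun x _ => (M x).charpoly_monic.ne_zero)]
  simp only [entropy_eq_sum_roots (hM _), Multiset.map_bind, Multiset.sum_bind]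
  rfl

theorem IsDensity.isHermitian {ρ : Matrix S S ℂ} (h : IsDensity ρ) : ρ.IsHermitian :=
  h.1.isHermitian

theorem entropy_cqBlock_smul {M : X → Matrix S S ℂ} (hM : ∀ x, IsDensity (M x)) (p : X → ℝ) :
    entropy (cqBlock fun x => (p x : ℂ) • M x)
      = ∑ x, p x * entropy (M x) + ∑ x, entropyTerm (p x) := by
  rw [entropy_cqBlock, ← Finset.sum_add_distrib]
  · exact Finset.sum_congr rfl fun x _ => by
      rw [entropy_smul (hM x).isHermitian, (hM x).2, Complex.one_re, one_mul]
  · intro x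
    rw [IsHermitian, conjTranspose_smul, (hM x).isHermitian.eq]; simp

end Entropy

/-! ### Information quantities of classical-quantum block states. -/

section BlockStates

variable {X Y S R T B E : Type*} [Fintype X] [DecidableEq X] [Fintype Y] [DecidableEq Y]
  [Fintype S] [DecidableEq S] [Fintype R] [DecidableEq R] [Fintype T] [DecidableEq T]
  [Fintype B] [DecidableEq B] [Fintype E] [DecidableEq E]

theorem partialTrace_eq_sum (f : S → R → T) (M : Matrix T T ℂ) :
    partialTrace f M = ∑ r, M.submatrix (fun s => f s r) (fun s => f s r) := by
  ext i j
  simp [partialTrace, Matrix.sum_apply]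

theorem partialTrace_smul (f : S → R → T) (c : ℂ) (M : Matrix T T ℂ) :
    partialTrace f (c • M) = c • partialTrace f M := by
  ext i j
  simp [partialTrace, Finset.mul_sum]

theorem posSemidef_partialTrace (f : S → R → T) {M : Matrix T T ℂ} (hM : M.PosSemidef) :
    (partialTrace f M).PosSemidef := by
  rw [partialTrace_eq_sum]
  exact posSemidef_sum _ fun r _ => hM.submatrix _

theorem trace_partialTrace (f : S × R ≃ T) (M : Matrix T T ℂ) :
    (partialTrace (fun s r => f (s, r)) M).trace = M.trace := by
  simp only [partialTrace, Matrix.trace, diag_apply, of_apply]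
  rw [← Fintype.sum_prod_type' (f := fun s r => M (f (s, r)) (f (s, r))), ← f.sum_comp]

theorem IsDensity.partialTrace {M : Matrix T T ℂ} (hM : IsDensity M) (f : S × R ≃ T) :
    IsDensity (partialTrace (fun s r => f (s, r)) M) :=
  ⟨posSemidef_partialTrace _ hM.1, by rw [trace_partialTrace, hM.2]⟩

theorem IsDensity.partialTrace_right {M : Matrix (S × R) (S × R) ℂ} (hM : IsDensity M) :
    IsDensity (QTradeoff.partialTrace (fun (s : S) (r : R) => (s, r)) M) :=
  hM.partialTrace (Equiv.refl _)

theorem IsDensity.partialTrace_left {M : Matrix (S × R) (S × R) ℂ} (hM : IsDensity M) :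
    IsDensity (QTradeoff.partialTrace (fun (r : R) (s : S) => (s, r)) M) :=
  hM.partialTrace (Equiv.prodComm R S)

theorem IsDensity.sum {ι : Type*} [Fintype ι] {p : ι → ℝ} (hp : p ∈ stdSimplex ℝ ι)
    {ρ : ι → Matrix S S ℂ} (hρ : ∀ i, IsDensity (ρ i)) : IsDensity (∑ i, (p i : ℂ) • ρ i) := by
  refine ⟨posSemidef_sum _ fun i _ => (hρ i).1.smul (by exact_mod_cast hp.1 i), ?_⟩
  simp only [trace_sum, trace_smul, (hρ _).2, smul_eq_mul, mul_one]
  exact_mod_cast hp.2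

theorem sum_single_kronecker (p : X → ℂ) (M : X → Matrix S S ℂ) :
    ∑ x, p x • (Matrix.single x x 1 ⊗ₖ M x) = cqBlock fun x => p x • M x := by
  ext ⟨x, s⟩ ⟨y, t⟩
  simp only [cqBlock, of_apply, Matrix.sum_apply, Matrix.smul_apply, kronecker_apply,
    single_apply]
  by_cases h : x = y
  · subst h; simp
  · simp only [h, if_false]
    refine Finset.sum_eq_zero fun z _ => ?_
    rw [if_neg (by rintro ⟨rfl, rfl⟩; exact h rfl)]
    simp

theorem isDensity_cqBlock {p : X → ℝ} (hp : p ∈ stdSimplex ℝ X) {M : X → Matrix S S ℂ}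
    (hM : ∀ x, IsDensity (M x)) : IsDensity (cqBlock fun x => (p x : ℂ) • M x) := by
  constructor
  · rw [← sum_single_kronecker]
    refine posSemidef_sum _ fun x _ => ((PosSemidef.kronecker ?_ (hM x).1).smul
      (by exact_mod_cast hp.1 x))
    rw [← diagonal_single]
    exact PosSemidef.diagonal (Pi.single_nonneg.2 zero_le_one)
  · simp only [Matrix.trace, diag_apply, Fintype.sum_prod_type, cqBlock, of_apply, if_true,
      Matrix.smul_apply, ← Finset.smul_sum]
    have h : ∀ x, ∑ s, M x s s = 1 := fun x => (hM x).2
    simp only [h, smul_eq_mul, mul_one]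
    exact_mod_cast hp.2

theorem partialTrace_cqBlock (f : S → R → T) (M : X → Matrix T T ℂ) :
    partialTrace (fun (xs : X × S) (r : R) => (xs.1, f xs.2 r)) (cqBlock M)
      = cqBlock fun x => partialTrace f (M x) := by
  ext ⟨x, s⟩ ⟨y, t⟩
  by_cases h : x = y <;> simp [partialTrace, cqBlock, h]

theorem partialTrace_cqBlock_quantum (M : X → Matrix S S ℂ) :
    partialTrace (fun (x : X) (s : S) => (x, s)) (cqBlock M) = diagonal fun x => (M x).trace := by
  ext x y
  by_cases h : x = y <;> simp [partialTrace, cqBlock, h, Matrix.trace]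

theorem partialTrace_cqBlock_classical (M : X → Matrix S S ℂ) :
    partialTrace (fun (s : S) (x : X) => (x, s)) (cqBlock M) = ∑ x, M x := by
  ext s t
  simp [partialTrace, cqBlock, Matrix.sum_apply]

/-- The Shannon entropy of `p` occurs in both the classical marginal and the joint entropy and
cancels, leaving the Holevo quantity. -/
theorem mutualInfo_cqBlock {p : X → ℝ} {M : X → Matrix S S ℂ} (hM : ∀ x, IsDensity (M x)) :
    mutualInfo (cqBlock fun x => (p x : ℂ) • M x)
      = entropy (∑ x, (p x : ℂ) • M x) - ∑ x, p x * entropy (M x) := by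
  rw [mutualInfo, partialTrace_cqBlock_quantum, partialTrace_cqBlock_classical,
    entropy_cqBlock_smul hM]
  simp only [trace_smul, (hM _).2, smul_eq_mul, mul_one]
  rw [entropy_diagonal]
  ring

theorem coherentInfo_cqBlock {p : X → ℝ} {M : X → Matrix (R × B) (R × B) ℂ}
    (hM : ∀ x, IsDensity (M x)) :
    coherentInfo (cqBlock fun x => (p x : ℂ) • M x)
      = ∑ x, p x * (entropy (partialTrace (fun (b : B) (r : R) => (r, b)) (M x))
          - entropy (M x)) := by
  rw [coherentInfo, partialTrace_cqBlock (fun (b : B) (r : R) => (r, b))]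
  simp only [partialTrace_smul]
  rw [entropy_cqBlock_smul hM, entropy_cqBlock_smul fun x => (hM x).partialTrace_left]
  simp only [mul_sub, Finset.sum_sub_distrib]
  ring

theorem condMutualInfo_cqBlock {p : X → ℝ} {M : X → Matrix (Y × B) (Y × B) ℂ}
    (hM : ∀ x, IsDensity (M x)) :
    condMutualInfo (cqBlock fun x => (p x : ℂ) • M x) = ∑ x, p x * mutualInfo (M x) := by
  rw [condMutualInfo, partialTrace_cqBlock (fun (y : Y) (b : B) => (y, b)),
    partialTrace_cqBlock (fun (b : B) (y : Y) => (y, b)), partialTrace_cqBlock_quantum]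
  simp only [partialTrace_smul, mutualInfo]
  rw [entropy_cqBlock_smul hM, entropy_cqBlock_smul fun x => (hM x).partialTrace_left,
    entropy_cqBlock_smul fun x => (hM x).partialTrace_right]
  simp only [trace_smul, (hM _).2, smul_eq_mul, mul_one]
  rw [entropy_diagonal]
  simp only [mul_sub, mul_add, Finset.sum_sub_distrib, Finset.sum_add_distrib]
  ring

end BlockStates

/-! ### The two objectives in terms of output and environment entropies. -/

section Formulas

variable {X Y R A B E : Type*} [Fintype X] [DecidableEq X] [Fintype Y] [DecidableEq Y]
  [Fintype R] [DecidableEq R] [Fintype A] [DecidableEq A]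
  [Fintype B] [DecidableEq B] [Fintype E] [DecidableEq E]
  {N : Matrix A A ℂ →ₗ[ℂ] Matrix B B ℂ} {V : Matrix (B × E) A ℂ}

theorem isDensity_isometry_conj (hV : Vᴴ * V = 1) {ρ : Matrix A A ℂ} (hρ : IsDensity ρ) :
    IsDensity (V * ρ * Vᴴ) :=
  ⟨hρ.1.mul_mul_conjTranspose_same V, by rw [trace_mul_cycle, hV, one_mul, hρ.2]⟩

theorem IsIsometricExtension.isDensity (hV : IsIsometricExtension N V) {ρ : Matrix A A ℂ}
    (hρ : IsDensity ρ) : IsDensity (N ρ) := by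
  rw [← hV.2]
  exact (isDensity_isometry_conj hV.1 hρ).partialTrace_right

theorem isDensity_complementary (hV : Vᴴ * V = 1) {ρ : Matrix A A ℂ}
    (hρ : IsDensity ρ) : IsDensity (complementary V ρ) :=
  (isDensity_isometry_conj hV hρ).partialTrace_left

/-- The complementary channel as a linear map. -/
def complementaryMap (V : Matrix (B × E) A ℂ) : Matrix A A ℂ →ₗ[ℂ] Matrix E E ℂ where
  toFun := complementary V
  map_add' ρ σ := by
    ext i j
    simp [complementary, partialTrace, Matrix.mul_add, Matrix.add_mul, Finset.sum_add_distrib]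
  map_smul' c ρ := by
    simp [complementary, partialTrace_smul]

@[simp] theorem complementaryMap_apply (V : Matrix (B × E) A ℂ) (ρ : Matrix A A ℂ) :
    complementaryMap V ρ = complementary V ρ := rfl

/-- The reduced operator on `A` of the operator `|φ⟩⟨φ|` on `R ⊗ A`. -/
def reducedState (φ : R × A → ℂ) : Matrix A A ℂ :=
  partialTrace (fun (a : A) (r : R) => (r, a)) (ketbra φ)

theorem trace_ketbra_eq_one_iff {v : A → ℂ} : (ketbra v).trace = 1 ↔ IsUnitVector v := by
  rw [ketbra, trace_vecMulVec, dotProduct]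
  simp only [Pi.star_apply, Complex.star_def, Complex.mul_conj, Complex.normSq_eq_norm_sq]
  exact_mod_cast Iff.rfl

theorem isDensity_ketbra {v : A → ℂ} (hv : IsUnitVector v) : IsDensity (ketbra v) :=
  ⟨posSemidef_vecMulVec_self_star v, trace_ketbra_eq_one_iff.2 hv⟩

theorem trace_reducedState (φ : R × A → ℂ) : (reducedState φ).trace = (ketbra φ).trace :=
  trace_partialTrace (Equiv.prodComm A R) _

theorem isDensity_reducedState {φ : R × A → ℂ} (hφ : IsUnitVector φ) :
    IsDensity (reducedState φ) :=
  (isDensity_ketbra hφ).partialTrace_left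

/-- The coefficients of `(1 ⊗ V) |φ⟩`, as an operator from `E` to `R ⊗ B`. -/
def outputAmplitude (V : Matrix (B × E) A ℂ) (φ : R × A → ℂ) : Matrix (R × B) E ℂ :=
  Matrix.of fun i e => ∑ a, V (i.2, e) a * φ (i.1, a)

theorem IsIsometricExtension.idTensor_ketbra (hV : IsIsometricExtension N V) (φ : R × A → ℂ) :
    idTensor N (ketbra φ) = outputAmplitude V φ * (outputAmplitude V φ)ᴴ := by
  ext ⟨r, b⟩ ⟨s, c⟩
  simp only [idTensor, ← hV.2, partialTrace, of_apply, mul_apply, conjTranspose_apply,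
    outputAmplitude, ketbra, vecMulVec_apply, Pi.star_apply, star_sum, star_mul', Finset.sum_mul,
    Finset.mul_sum]
  refine Finset.sum_congr rfl fun e _ => ?_
  exact Finset.sum_congr rfl fun a _ => Finset.sum_congr rfl fun a' _ => by ring

theorem mul_ketbra_mul (V : Matrix (B × E) A ℂ) (v : A → ℂ) :
    V * ketbra v * Vᴴ = ketbra (V *ᵥ v) := by
  rw [ketbra, mul_vecMulVec, vecMulVec_mul, ketbra, star_mulVec]

theorem reducedState_eq_sum (φ : R × A → ℂ) :
    reducedState φ = ∑ r, ketbra fun a => φ (r, a) := by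
  ext a a'
  simp [reducedState, partialTrace, Matrix.sum_apply, ketbra, vecMulVec_apply]

theorem complementary_reducedState (V : Matrix (B × E) A ℂ) (φ : R × A → ℂ) :
    complementary V (reducedState φ) = ((outputAmplitude V φ)ᴴ * outputAmplitude V φ)ᵀ := by
  rw [reducedState_eq_sum, ← complementaryMap_apply, map_sum]
  ext e f
  simp only [complementaryMap_apply, complementary, mul_ketbra_mul, Matrix.sum_apply]
  simp only [partialTrace, of_apply, ketbra, vecMulVec_apply, Pi.star_apply, transpose_apply,
    mul_apply, conjTranspose_apply, Fintype.sum_prod_type]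
  exact Finset.sum_congr rfl fun r _ => Finset.sum_congr rfl fun b _ => mul_comm _ _

/-- The vector `(1 ⊗ V)|φ⟩` on `R ⊗ B ⊗ E` is pure, so its marginals on `R ⊗ B` and on `E` share
their nonzero spectrum. -/
theorem IsIsometricExtension.entropy_idTensor (hV : IsIsometricExtension N V) (φ : R × A → ℂ) :
    entropy (idTensor N (ketbra φ)) = entropy (complementary V (reducedState φ)) := by
  rw [hV.idTensor_ketbra, complementary_reducedState, entropy_mul_conjTranspose,
    entropy_transpose (isHermitian_conjTranspose_mul_self _)]

theorem partialTrace_idTensor (φ : R × A → ℂ) :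
    partialTrace (fun (b : B) (r : R) => (r, b)) (idTensor N (ketbra φ))
      = N (reducedState φ) := by
  have h : reducedState φ = ∑ r, Matrix.of fun a a' => ketbra φ (r, a) (r, a') := by
    ext a a'
    simp [reducedState, partialTrace, Matrix.sum_apply]
  rw [h, map_sum]
  ext b b'
  simp [partialTrace, idTensor, Matrix.sum_apply]

theorem IsIsometricExtension.isDensity_idTensor (hV : IsIsometricExtension N V) {φ : R × A → ℂ}
    (hφ : IsUnitVector φ) : IsDensity (idTensor N (ketbra φ)) := by
  constructor
  · rw [hV.idTensor_ketbra]
    exact posSemidef_self_mul_conjTranspose _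
  · rw [hV.idTensor_ketbra, trace_mul_comm, ← trace_transpose, ← complementary_reducedState]
    exact (isDensity_complementary hV.1 (isDensity_reducedState hφ)).2

/-- The conditional output entropy subtracted in `I(X;B)` cancels one of the `1 + μ` copies coming
from the coherent information; hence the coefficient `μ`. -/
theorem IsIsometricExtension.cqObjective_cqState (hV : IsIsometricExtension N V) (μ : ℝ)
    (p : X → ℝ) {φ : X → R × A → ℂ} (hφ : ∀ x, IsUnitVector (φ x)) :
    cqObjective μ (cqState N p φ)
      = entropy (N (∑ x, (p x : ℂ) • reducedState (φ x)))
        + ∑ x, p x * (μ * entropy (N (reducedState (φ x)))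
          - (1 + μ) * entropy (complementary V (reducedState (φ x)))) := by
  have hd := fun x => hV.isDensity_idTensor (hφ x)
  rw [cqObjective, cqState, sum_single_kronecker, coherentInfo_cqBlock hd,
    partialTrace_cqBlock (fun (b : B) (r : R) => (r, b))]
  simp only [partialTrace_smul, partialTrace_idTensor, hV.entropy_idTensor]
  rw [mutualInfo_cqBlock fun x => hV.isDensity (isDensity_reducedState (hφ x))]
  simp only [map_sum, map_smul, mul_sub, Finset.sum_sub_distrib, Finset.mul_sum]
  simp only [add_mul, mul_add, one_mul, Finset.sum_add_distrib, mul_left_comm _ μ]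
  ring

/-- Given `x`, the difference of the two Holevo quantities is the coherent information of the mean
input minus the mean coherent information. -/
theorem IsIsometricExtension.ppObjective_ppState (hV : IsIsometricExtension N V) (μ : ℝ)
    (p : X → ℝ) {q : X → Y → ℝ} (hq : ∀ x, q x ∈ stdSimplex ℝ Y) {ρ : X → Y → Matrix A A ℂ}
    (hρ : ∀ x y, IsDensity (ρ x y)) :
    ppObjective μ (ppState V (fun z => p z.1 * q z.1 z.2) ρ)
      = entropy (N (∑ x, (p x : ℂ) • ∑ y, (q x y : ℂ) • ρ x y))
        + ∑ x, p x * (μ * entropy (N (∑ y, (q x y : ℂ) • ρ x y))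
          - (1 + μ) * entropy (complementary V (∑ y, (q x y : ℂ) • ρ x y))
          - (1 + μ) * ∑ y, q x y * (entropy (N (ρ x y)) - entropy (complementary V (ρ x y)))) := by
  have hstate : ppState V (fun z => p z.1 * q z.1 z.2) ρ
      = cqBlock fun x => (p x : ℂ) • cqBlock fun y => (q x y : ℂ) • (V * ρ x y * Vᴴ) := by
    rw [← sum_single_kronecker, ppState]
    refine Finset.sum_congr rfl fun x _ => ?_
    rw [← sum_single_kronecker]
    ext ⟨x', s⟩ ⟨y', t⟩
    simp only [Complex.ofReal_mul, Matrix.sum_apply, Matrix.smul_apply, kronecker_apply,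
      smul_eq_mul, Finset.mul_sum]
    exact Finset.sum_congr rfl fun y _ => by ring
  have hN := fun x y => hV.isDensity (hρ x y)
  have hC := fun x y => isDensity_complementary hV.1 (hρ x y)
  have hXB : partialTrace (fun (xb : X × B) (ye : Y × E) => (xb.1, ye.1, xb.2, ye.2))
      (ppState V (fun z => p z.1 * q z.1 z.2) ρ)
      = cqBlock fun x => (p x : ℂ) • ∑ y, (q x y : ℂ) • N (ρ x y) := by
    rw [hstate, partialTrace_cqBlock (fun (b : B) (ye : Y × E) => (ye.1, b, ye.2))]
    simp only [partialTrace_smul, ← hV.2]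
    congr! 3
    ext b b'
    simp [partialTrace, cqBlock, Matrix.sum_apply, Fintype.sum_prod_type, Finset.mul_sum]
  have hXYB : partialTrace (fun (s : X × Y × B) (e : E) => (s.1, s.2.1, s.2.2, e))
      (ppState V (fun z => p z.1 * q z.1 z.2) ρ)
      = cqBlock fun x => (p x : ℂ) • cqBlock fun y => (q x y : ℂ) • N (ρ x y) := by
    rw [hstate, partialTrace_cqBlock (fun (s : Y × B) (e : E) => (s.1, s.2, e))]
    simp only [partialTrace_smul]
    simp only [partialTrace_cqBlock (fun (b : B) (e : E) => (b, e)), partialTrace_smul, hV.2]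
  have hXYE : partialTrace (fun (s : X × Y × E) (b : B) => (s.1, s.2.1, b, s.2.2))
      (ppState V (fun z => p z.1 * q z.1 z.2) ρ)
      = cqBlock fun x => (p x : ℂ) • cqBlock fun y => (q x y : ℂ) • complementary V (ρ x y) := by
    rw [hstate, partialTrace_cqBlock (fun (s : Y × E) (b : B) => (s.1, b, s.2))]
    simp only [partialTrace_smul]
    simp only [partialTrace_cqBlock (fun (e : E) (b : B) => (b, e)), partialTrace_smul]
    rfl
  simp only [ppObjective]
  rw [hXB, hXYB, hXYE, mutualInfo_cqBlock fun x => IsDensity.sum (hq x) (hN x),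
    condMutualInfo_cqBlock fun x => isDensity_cqBlock (hq x) (hN x),
    condMutualInfo_cqBlock fun x => isDensity_cqBlock (hq x) (hC x)]
  simp only [mutualInfo_cqBlock (hN _), mutualInfo_cqBlock (hC _)]
  simp only [← complementaryMap_apply, map_sum, map_smul]
  simp only [mul_sub, Finset.sum_sub_distrib, Finset.mul_sum]
  simp only [add_mul, mul_add, one_mul, Finset.sum_add_distrib, mul_left_comm _ μ]
  ring

/-- The case of a one-dimensional reference: a pure input makes the output on `B ⊗ E` pure. -/
theorem IsIsometricExtension.entropy_complementary_ketbra (hV : IsIsometricExtension N V)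
    (v : A → ℂ) : entropy (complementary V (ketbra v)) = entropy (N (ketbra v)) := by
  have h1 : reducedState (fun i : Unit × A => v i.2) = ketbra v := by
    ext a a'
    simp [reducedState, partialTrace, ketbra, vecMulVec_apply]
  have h2 : (idTensor N (ketbra fun i : Unit × A => v i.2)).submatrix
      (Equiv.punitProd B).symm (Equiv.punitProd B).symm = N (ketbra v) := by
    ext b b'
    rfl
  have h3 := hV.entropy_idTensor (fun i : Unit × A => v i.2)
  rw [h1] at h3
  rw [← h3, ← h2, entropy_submatrix]
  rw [hV.idTensor_ketbra]
  exact isHermitian_mul_conjTranspose_self _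

-- Purification: if `ρ = C† C`, the conjugated entries of `C` are the amplitudes. The bijection `e`
-- lets the reference be a `Fin d`.
open scoped MatrixOrder Matrix.Norms.L2Operator in
theorem exists_isUnitVector_reducedState {ρ : Matrix A A ℂ} (hρ : IsDensity ρ) (e : R ≃ A) :
    ∃ φ : R × A → ℂ, IsUnitVector φ ∧ reducedState φ = ρ := by
  obtain ⟨C, hC⟩ := CStarAlgebra.nonneg_iff_eq_star_mul_self.1 hρ.1.nonneg
  rw [star_eq_conjTranspose] at hC
  have h : reducedState (fun i : R × A => star (C (e i.1) i.2)) = ρ := by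
    ext a a'
    simp only [hC, reducedState, partialTrace, ketbra, vecMulVec_apply, of_apply, mul_apply,
      conjTranspose_apply, Pi.star_apply, star_star]
    exact e.sum_comp fun r => star (C r a) * C r a'
  refine ⟨_, ?_, h⟩
  rw [← trace_ketbra_eq_one_iff, ← trace_reducedState, h, hρ.2]

end Formulas

/-! ### A variational resolvent quantity and its monotonicity under channels. -/

section Monotonicity

variable {S T : Type*} [Fintype S] [DecidableEq S] [Fintype T] [DecidableEq T]

/-- The concave quadratic functional of `X` whose maximum is the resolvent quantity
`⟨ρ, (L_σ + s R_ρ)⁻¹ ρ⟩` in the Hilbert–Schmidt inner product. -/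
def resolventTest (ρ σ : Matrix S S ℂ) (s : ℝ) (X : Matrix S S ℂ) : ℝ :=
  2 * (Xᴴ * ρ).trace.re - (Xᴴ * σ * X).trace.re - s * (Xᴴ * X * ρ).trace.re

/-- The squared overlap of the `j`-th eigenvector of `σ` and the `i`-th eigenvector of `ρ`. -/
def overlap {ρ σ : Matrix S S ℂ} (hρ : ρ.IsHermitian) (hσ : σ.IsHermitian) (j i : S) : ℝ :=
  Complex.normSq (((hσ.eigenvectorUnitary : Matrix S S ℂ)ᴴ * hρ.eigenvectorUnitary) j i)

theorem spectral_eq {ρ : Matrix S S ℂ} (hρ : ρ.IsHermitian) :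
    ρ = (hρ.eigenvectorUnitary : Matrix S S ℂ) * diagonal (fun i => (hρ.eigenvalues i : ℂ))
      * (hρ.eigenvectorUnitary : Matrix S S ℂ)ᴴ := by
  conv_lhs => rw [hρ.spectral_theorem, Unitary.conjStarAlgAut_apply]
  rfl

theorem conjTranspose_eigenvectorUnitary_mul {ρ : Matrix S S ℂ} (hρ : ρ.IsHermitian) :
    (hρ.eigenvectorUnitary : Matrix S S ℂ)ᴴ * (hρ.eigenvectorUnitary : Matrix S S ℂ) = 1 :=
  Unitary.coe_star_mul_self _

theorem eigenvectorUnitary_mul_conjTranspose {ρ : Matrix S S ℂ} (hρ : ρ.IsHermitian) :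
    (hρ.eigenvectorUnitary : Matrix S S ℂ) * (hρ.eigenvectorUnitary : Matrix S S ℂ)ᴴ = 1 :=
  Unitary.coe_mul_star_self _

/-- In the eigenbases of `σ` (rows) and `ρ` (columns) the functional decouples into one scalar
quadratic per entry. -/
theorem resolventTest_conj {ρ σ : Matrix S S ℂ} (hρ : ρ.IsHermitian) (hσ : σ.IsHermitian) (s : ℝ)
    (Y : Matrix S S ℂ) :
    resolventTest ρ σ s ((hσ.eigenvectorUnitary : Matrix S S ℂ) * Y
        * (hρ.eigenvectorUnitary : Matrix S S ℂ)ᴴ)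
      = ∑ j, ∑ i, (2 * hρ.eigenvalues i * (star (Y j i)
          * ((hσ.eigenvectorUnitary : Matrix S S ℂ)ᴴ * hρ.eigenvectorUnitary) j i).re
        - (hσ.eigenvalues j + s * hρ.eigenvalues i) * Complex.normSq (Y j i)) := by
  have hU := conjTranspose_eigenvectorUnitary_mul hρ
  have hW := conjTranspose_eigenvectorUnitary_mul hσ
  have eρ := spectral_eq hρ
  have eσ := spectral_eq hσ
  set U := (hρ.eigenvectorUnitary : Matrix S S ℂ)
  set W := (hσ.eigenvectorUnitary : Matrix S S ℂ)
  set Z := Wᴴ * U with hZ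
  set Λ := diagonal (fun i => (hρ.eigenvalues i : ℂ)) with hΛ
  set M := diagonal (fun i => (hσ.eigenvalues i : ℂ)) with hM
  have hU' : ∀ N : Matrix S S ℂ, Uᴴ * (U * N) = N := fun N => by rw [← mul_assoc, hU, one_mul]
  have hW' : ∀ N : Matrix S S ℂ, Wᴴ * (W * N) = N := fun N => by rw [← mul_assoc, hW, one_mul]
  have h1 : ((W * Y * Uᴴ)ᴴ * ρ).trace = (Yᴴ * (Z * Λ)).trace := by
    rw [eρ, conjTranspose_mul, conjTranspose_mul, conjTranspose_conjTranspose]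
    rw [show U * (Yᴴ * Wᴴ) * (U * Λ * Uᴴ) = U * (Yᴴ * (Wᴴ * U * Λ) * Uᴴ) by
      simp only [mul_assoc], trace_mul_comm, mul_assoc, hU, mul_one]
  have h2 : ((W * Y * Uᴴ)ᴴ * σ * (W * Y * Uᴴ)).trace = (Yᴴ * (M * Y)).trace := by
    rw [eσ, conjTranspose_mul, conjTranspose_mul, conjTranspose_conjTranspose]
    rw [show U * (Yᴴ * Wᴴ) * (W * M * Wᴴ) * (W * Y * Uᴴ) = U * (Yᴴ * (M * Y) * Uᴴ) by
      simp only [mul_assoc, hW'], trace_mul_comm, mul_assoc, hU, mul_one]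
  have h3 : ((W * Y * Uᴴ)ᴴ * (W * Y * Uᴴ) * ρ).trace = (Yᴴ * (Y * Λ)).trace := by
    rw [eρ, conjTranspose_mul, conjTranspose_mul, conjTranspose_conjTranspose]
    rw [show U * (Yᴴ * Wᴴ) * (W * Y * Uᴴ) * (U * Λ * Uᴴ) = U * (Yᴴ * (Y * Λ) * Uᴴ) by
      simp only [mul_assoc, hW', hU'], trace_mul_comm, mul_assoc, hU, mul_one]
  have key : ∀ N : Matrix S S ℂ, (Yᴴ * N).trace = ∑ j, ∑ i, star (Y j i) * N j i := fun N => by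
    simp only [Matrix.trace, diag_apply, mul_apply, conjTranspose_apply]
    exact Finset.sum_comm
  rw [resolventTest, h1, h2, h3, key, key, key]
  simp only [hΛ, hM, mul_diagonal, diagonal_mul, Complex.re_sum, Finset.mul_sum,
    ← Finset.sum_sub_distrib]
  refine Finset.sum_congr rfl fun j _ => Finset.sum_congr rfl fun i _ => ?_
  simp only [Complex.star_def, Complex.mul_re, Complex.mul_im, Complex.conj_re, Complex.conj_im,
    Complex.ofReal_re, Complex.ofReal_im, Complex.normSq_apply]
  ring

/-- The maximum of `resolventTest`. -/
def resolventValue {ρ σ : Matrix S S ℂ} (hρ : ρ.IsHermitian) (hσ : σ.IsHermitian) (s : ℝ) : ℝ :=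
  ∑ j, ∑ i, overlap hρ hσ j i
    * (hρ.eigenvalues i * (hρ.eigenvalues i / (hσ.eigenvalues j + s * hρ.eigenvalues i)))

/-- Completing the square. For `l = 0` the right side vanishes, even when the quotient is `0 / 0`.
-/
theorem two_mul_re_sub_le (y z : ℂ) {l m s : ℝ} (hl : 0 ≤ l) (hm : 0 ≤ m) (hs : 0 < s) :
    2 * l * (star y * z).re - (m + s * l) * Complex.normSq y
      ≤ Complex.normSq z * (l * (l / (m + s * l))) := by
  rcases hl.eq_or_lt with rfl | hl
  · simpa using mul_nonneg hm (Complex.normSq_nonneg y)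
  · have hd : 0 < m + s * l := by positivity
    have h : Complex.normSq z * (l * (l / (m + s * l)))
        - (2 * l * (star y * z).re - (m + s * l) * Complex.normSq y)
        = ((l * z.re - (m + s * l) * y.re) ^ 2 + (l * z.im - (m + s * l) * y.im) ^ 2)
          / (m + s * l) := by
      simp only [Complex.star_def, Complex.mul_re, Complex.conj_re, Complex.conj_im,
        Complex.normSq_apply]
      field_simp
      ring
    have : 0 ≤ ((l * z.re - (m + s * l) * y.re) ^ 2 + (l * z.im - (m + s * l) * y.im) ^ 2)
          / (m + s * l) := by positivity
    linarith

theorem two_mul_re_sub_eq (z : ℂ) {l m s : ℝ} (hl : 0 ≤ l) (hm : 0 ≤ m) (hs : 0 < s) :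
    2 * l * (star (((l / (m + s * l) : ℝ) : ℂ) * z) * z).re
        - (m + s * l) * Complex.normSq (((l / (m + s * l) : ℝ) : ℂ) * z)
      = Complex.normSq z * (l * (l / (m + s * l))) := by
  rcases hl.eq_or_lt with rfl | hl
  · simp
  · have hd : 0 < m + s * l := by positivity
    simp only [Complex.star_def, Complex.mul_re, Complex.mul_im, Complex.conj_re, Complex.conj_im,
        Complex.normSq_apply, Complex.ofReal_re, Complex.ofReal_im]
    field_simp
    ring

theorem resolventTest_le {ρ σ : Matrix S S ℂ} (hρ : ρ.PosSemidef) (hσ : σ.PosSemidef) {s : ℝ}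
    (hs : 0 < s) (X : Matrix S S ℂ) :
    resolventTest ρ σ s X ≤ resolventValue hρ.isHermitian hσ.isHermitian s := by
  have hX : X = (hσ.isHermitian.eigenvectorUnitary : Matrix S S ℂ)
      * ((hσ.isHermitian.eigenvectorUnitary : Matrix S S ℂ)ᴴ * X
        * (hρ.isHermitian.eigenvectorUnitary : Matrix S S ℂ))
      * (hρ.isHermitian.eigenvectorUnitary : Matrix S S ℂ)ᴴ := by
    rw [mul_assoc, mul_assoc, mul_assoc, eigenvectorUnitary_mul_conjTranspose, ← mul_assoc,
      eigenvectorUnitary_mul_conjTranspose, one_mul, mul_one]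
  rw [hX, resolventTest_conj]
  exact Finset.sum_le_sum fun j _ => Finset.sum_le_sum fun i _ =>
    two_mul_re_sub_le _ _ (hρ.eigenvalues_nonneg i) (hσ.eigenvalues_nonneg j) hs

theorem exists_resolventTest_eq {ρ σ : Matrix S S ℂ} (hρ : ρ.PosSemidef) (hσ : σ.PosSemidef)
    {s : ℝ} (hs : 0 < s) :
    ∃ X, resolventTest ρ σ s X = resolventValue hρ.isHermitian hσ.isHermitian s := by
  refine ⟨_, (resolventTest_conj hρ.isHermitian hσ.isHermitian s (Matrix.of fun j i =>
    ((hρ.isHermitian.eigenvalues i / (hσ.isHermitian.eigenvalues j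
      + s * hρ.isHermitian.eigenvalues i) : ℝ) : ℂ)
      * ((hσ.isHermitian.eigenvectorUnitary : Matrix S S ℂ)ᴴ
        * (hρ.isHermitian.eigenvectorUnitary : Matrix S S ℂ)) j i)).trans ?_⟩
  exact Finset.sum_congr rfl fun j _ => Finset.sum_congr rfl fun i _ =>
    two_mul_re_sub_eq _ (hρ.eigenvalues_nonneg i) (hσ.eigenvalues_nonneg j) hs

variable {k : ℕ} {K : Fin k → Matrix T S ℂ}

/-- The Schwarz inequality for the dual of a channel, in trace form. -/
theorem trace_dual_mul_le (hK : ∑ l, (K l)ᴴ * K l = 1) {σ : Matrix S S ℂ} (hσ : σ.PosSemidef)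
    (X : Matrix T T ℂ) :
    ((∑ l, (K l)ᴴ * X * K l)ᴴ * σ * (∑ l, (K l)ᴴ * X * K l)).trace.re
      ≤ (Xᴴ * (∑ l, K l * σ * (K l)ᴴ) * X).trace.re := by
  set Z := ∑ l, (K l)ᴴ * X * K l with hZ
  -- The deviations `K† X - Z K†` form a variance: after expansion and summation, `∑ K† K = 1`
  -- reduces the cross and last terms to a single `-Tr (Z† σ Z)`.
  have hpos : 0 ≤ (∑ l, (((K l)ᴴ * X - Z * (K l)ᴴ)ᴴ * σ * ((K l)ᴴ * X - Z * (K l)ᴴ)).trace).re := by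
    rw [Complex.re_sum]
    refine Finset.sum_nonneg fun l _ => ?_
    exact (Complex.nonneg_iff.1 (hσ.conjTranspose_mul_mul_same _).trace_nonneg).1
  have hexp : ∀ l, (((K l)ᴴ * X - Z * (K l)ᴴ)ᴴ * σ * ((K l)ᴴ * X - Z * (K l)ᴴ)).trace
      = (Xᴴ * (K l * σ * (K l)ᴴ) * X).trace - (Zᴴ * σ * ((K l)ᴴ * X * K l)).trace
        - (((K l)ᴴ * X * K l)ᴴ * σ * Z).trace + (Zᴴ * σ * Z * ((K l)ᴴ * K l)).trace := by
    intro l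
    simp only [conjTranspose_sub, conjTranspose_mul, conjTranspose_conjTranspose,
      Matrix.sub_mul, Matrix.mul_sub, trace_sub]
    have e1 : (K l * Zᴴ * σ * ((K l)ᴴ * X)).trace = (Zᴴ * σ * ((K l)ᴴ * X * K l)).trace := by
      simp only [Matrix.mul_assoc]
      rw [trace_mul_comm]
      simp only [Matrix.mul_assoc]
    have e2 : (Xᴴ * K l * σ * (Z * (K l)ᴴ)).trace
        = ((K l)ᴴ * (Xᴴ * K l) * σ * Z).trace := by
      rw [← Matrix.mul_assoc, trace_mul_comm]; simp only [Matrix.mul_assoc]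
    have e3 : (K l * Zᴴ * σ * (Z * (K l)ᴴ)).trace = (Zᴴ * σ * Z * ((K l)ᴴ * K l)).trace := by
      simp only [Matrix.mul_assoc]
      rw [trace_mul_comm]
      simp only [Matrix.mul_assoc]
    rw [e1, e2, e3]
    simp only [Matrix.mul_assoc]
    ring
  have hsum : ∑ l, (((K l)ᴴ * X - Z * (K l)ᴴ)ᴴ * σ * ((K l)ᴴ * X - Z * (K l)ᴴ)).trace
      = (Xᴴ * (∑ l, K l * σ * (K l)ᴴ) * X).trace - (Zᴴ * σ * Z).trace := by
    simp only [hexp, Finset.sum_add_distrib, Finset.sum_sub_distrib, ← trace_sum, ← Matrix.mul_sum,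
      ← Matrix.sum_mul, hK, ← conjTranspose_sum, ← hZ, mul_one]
    ring
  rw [hsum, Complex.sub_re] at hpos
  linarith

/-- Duality preserves the linear term; the quadratic terms need the Schwarz inequality once for `X`
with `σ` and once for `Xᴴ` with `ρ`. -/
theorem resolventTest_dual_ge (hK : ∑ l, (K l)ᴴ * K l = 1) {ρ σ : Matrix S S ℂ}
    (hρ : ρ.PosSemidef) (hσ : σ.PosSemidef) {s : ℝ} (hs : 0 < s) (X : Matrix T T ℂ) :
    resolventTest (∑ l, K l * ρ * (K l)ᴴ) (∑ l, K l * σ * (K l)ᴴ) s X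
      ≤ resolventTest ρ σ s (∑ l, (K l)ᴴ * X * K l) := by
  have h1 : (Xᴴ * ∑ l, K l * ρ * (K l)ᴴ).trace = ((∑ l, (K l)ᴴ * X * K l)ᴴ * ρ).trace := by
    simp only [conjTranspose_sum, conjTranspose_mul, conjTranspose_conjTranspose, Matrix.sum_mul,
      Matrix.mul_sum, trace_sum]
    refine Finset.sum_congr rfl fun l _ => ?_
    rw [← Matrix.mul_assoc, trace_mul_comm]; simp only [Matrix.mul_assoc]
  have h2 := trace_dual_mul_le hK hσ X
  have h3 := trace_dual_mul_le hK hρ Xᴴ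
  have h4 : (∑ l, (K l)ᴴ * Xᴴ * K l) = (∑ l, (K l)ᴴ * X * K l)ᴴ := by
    simp only [conjTranspose_sum, conjTranspose_mul, conjTranspose_conjTranspose, Matrix.mul_assoc]
  rw [h4, conjTranspose_conjTranspose, conjTranspose_conjTranspose, trace_mul_cycle,
    trace_mul_cycle X] at h3
  simp only [resolventTest, h1]
  linarith [mul_le_mul_of_nonneg_left h3 hs.le]

theorem resolventValue_mono (hK : ∑ l, (K l)ᴴ * K l = 1) {ρ σ : Matrix S S ℂ}
    (hρ : ρ.PosSemidef) (hσ : σ.PosSemidef)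
    (hρ' : (∑ l, K l * ρ * (K l)ᴴ).PosSemidef) (hσ' : (∑ l, K l * σ * (K l)ᴴ).PosSemidef)
    {s : ℝ} (hs : 0 < s) :
    resolventValue hρ'.isHermitian hσ'.isHermitian s
      ≤ resolventValue hρ.isHermitian hσ.isHermitian s := by
  obtain ⟨X, hX⟩ := exists_resolventTest_eq hρ' hσ' hs
  rw [← hX]
  exact (resolventTest_dual_ge hK hρ hσ hs X).trans (resolventTest_le hρ hσ hs _)

end Monotonicity

/-! ### Monotonicity of relative entropy and of the Holevo quantity. -/

section RelativeEntropy

open Filter Topology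

variable {S T : Type*} [Fintype S] [DecidableEq S] [Fintype T] [DecidableEq T]

theorem overlap_nonneg {ρ σ : Matrix S S ℂ} (hρ : ρ.IsHermitian) (hσ : σ.IsHermitian) (j i : S) :
    0 ≤ overlap hρ hσ j i :=
  Complex.normSq_nonneg _

theorem sum_overlap {ρ σ : Matrix S S ℂ} (hρ : ρ.IsHermitian) (hσ : σ.IsHermitian) (i : S) :
    ∑ j, overlap hρ hσ j i = 1 := by
  have hU := conjTranspose_eigenvectorUnitary_mul hρ
  have hW := eigenvectorUnitary_mul_conjTranspose hσ
  simp only [overlap]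
  set U := (hρ.eigenvectorUnitary : Matrix S S ℂ)
  set W := (hσ.eigenvectorUnitary : Matrix S S ℂ)
  have h : ((Wᴴ * U)ᴴ * (Wᴴ * U)) i i = 1 := by
    rw [conjTranspose_mul, conjTranspose_conjTranspose, mul_assoc, ← mul_assoc W, hW, one_mul, hU,
      one_apply_eq]
  rw [mul_apply] at h
  simp only [conjTranspose_apply, Complex.star_def, ← Complex.normSq_eq_conj_mul_self] at h
  exact_mod_cast h

/-- The diagonal entry of `ρ` at the `j`-th eigenvector of `σ`. -/
def eigenWeight {σ : Matrix S S ℂ} (hσ : σ.IsHermitian) (ρ : Matrix S S ℂ) (j : S) : ℝ :=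
  (((hσ.eigenvectorUnitary : Matrix S S ℂ)ᴴ * ρ * hσ.eigenvectorUnitary) j j).re

theorem sum_overlap_mul {ρ σ : Matrix S S ℂ} (hρ : ρ.IsHermitian) (hσ : σ.IsHermitian) (j : S) :
    ∑ i, overlap hρ hσ j i * hρ.eigenvalues i = eigenWeight hσ ρ j := by
  have eρ := spectral_eq hρ
  simp only [overlap, eigenWeight]
  set U := (hρ.eigenvectorUnitary : Matrix S S ℂ)
  set W := (hσ.eigenvectorUnitary : Matrix S S ℂ)
  set Λ := diagonal (fun i => (hρ.eigenvalues i : ℂ)) with hΛ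
  have h : Wᴴ * ρ * W = (Wᴴ * U) * Λ * (Wᴴ * U)ᴴ := by
    conv_lhs => rw [eρ]
    simp only [conjTranspose_mul, conjTranspose_conjTranspose, mul_assoc]
  rw [h, mul_apply, Complex.re_sum]
  refine Finset.sum_congr rfl fun i _ => ?_
  rw [hΛ, mul_diagonal, conjTranspose_apply, Complex.star_def, mul_right_comm, Complex.mul_conj,
    ← Complex.ofReal_mul, Complex.ofReal_re]

theorem eigenWeight_self {σ : Matrix S S ℂ} (hσ : σ.IsHermitian) (j : S) :
    eigenWeight hσ σ j = hσ.eigenvalues j := by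
  have eσ := spectral_eq hσ
  have hW := conjTranspose_eigenvectorUnitary_mul hσ
  simp only [eigenWeight]
  set W := (hσ.eigenvectorUnitary : Matrix S S ℂ)
  set Λ := diagonal (fun i => (hσ.eigenvalues i : ℂ)) with hΛ
  have h : Wᴴ * σ * W = Λ := by
    conv_lhs => rw [eσ]
    rw [mul_assoc, mul_assoc, hW, mul_one, ← mul_assoc, hW, one_mul]
  rw [h, hΛ, diagonal_apply_eq, Complex.ofReal_re]

theorem eigenWeight_nonneg {σ : Matrix S S ℂ} (hσ : σ.IsHermitian) {ρ : Matrix S S ℂ}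
    (hρ : ρ.PosSemidef) (j : S) : 0 ≤ eigenWeight hσ ρ j :=
  (Complex.nonneg_iff.1 (hρ.conjTranspose_mul_mul_same _).diag_nonneg).1

theorem eigenWeight_sub {σ : Matrix S S ℂ} (hσ : σ.IsHermitian) (ρ τ : Matrix S S ℂ) (j : S) :
    eigenWeight hσ (ρ - τ) j = eigenWeight hσ ρ j - eigenWeight hσ τ j := by
  simp [eigenWeight, mul_sub, sub_mul]

theorem eigenWeight_smul {σ : Matrix S S ℂ} (hσ : σ.IsHermitian) (c : ℝ) (ρ : Matrix S S ℂ)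
    (j : S) : eigenWeight hσ ((c : ℂ) • ρ) j = c * eigenWeight hσ ρ j := by
  simp [eigenWeight]

theorem eigenWeight_sum {σ : Matrix S S ℂ} (hσ : σ.IsHermitian) {ι : Type*} [Fintype ι]
    (ρ : ι → Matrix S S ℂ) (j : S) :
    eigenWeight hσ (∑ i, ρ i) j = ∑ i, eigenWeight hσ (ρ i) j := by
  simp [eigenWeight, Finset.mul_sum, Finset.sum_mul, Matrix.sum_apply]

/-- A primitive of `resolventValue` in `s`. -/
def resolventPrimitive {ρ σ : Matrix S S ℂ} (hρ : ρ.IsHermitian) (hσ : σ.IsHermitian) (s : ℝ) : ℝ :=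
  ∑ j, ∑ i, overlap hρ hσ j i
    * (hρ.eigenvalues i * Real.log (hσ.eigenvalues j + s * hρ.eigenvalues i))

theorem hasDerivAt_resolventPrimitive {ρ σ : Matrix S S ℂ} (hρ : ρ.PosSemidef)
    (hσ : σ.PosSemidef) {s : ℝ} (hs : 0 < s) :
    HasDerivAt (resolventPrimitive hρ.isHermitian hσ.isHermitian)
      (resolventValue hρ.isHermitian hσ.isHermitian s) s := by
  refine HasDerivAt.fun_sum fun j _ => HasDerivAt.fun_sum fun i _ => HasDerivAt.const_mul _ ?_
  rcases (hρ.eigenvalues_nonneg i).eq_or_lt with h | h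
  · simpa [← h] using hasDerivAt_const s (0 : ℝ)
  · refine HasDerivAt.const_mul _ (HasDerivAt.log ?_ ?_)
    · simpa using ((hasDerivAt_id s).mul_const (hρ.isHermitian.eigenvalues i)).const_add
        (hσ.isHermitian.eigenvalues j)
    · have := hσ.eigenvalues_nonneg j
      positivity

/-- `Tr (ρ log σ)`. -/
def traceMulLog {σ : Matrix S S ℂ} (hσ : σ.IsHermitian) (ρ : Matrix S S ℂ) : ℝ :=
  ∑ j, eigenWeight hσ ρ j * Real.log (hσ.eigenvalues j)

theorem tendsto_resolventPrimitive_zero {ρ σ : Matrix S S ℂ} (hρ : ρ.PosSemidef)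
    (hσ : σ.PosSemidef) {c : ℝ} (hc : 0 < c) (h : (σ - (c : ℂ) • ρ).PosSemidef) :
    Tendsto (resolventPrimitive hρ.isHermitian hσ.isHermitian) (𝓝[>] 0)
      (𝓝 (traceMulLog hσ.isHermitian ρ)) := by
  have hlim : traceMulLog hσ.isHermitian ρ = ∑ j, ∑ i, overlap hρ.isHermitian hσ.isHermitian j i
      * (hρ.isHermitian.eigenvalues i * Real.log (hσ.isHermitian.eigenvalues j)) := by
    simp only [traceMulLog, ← sum_overlap_mul hρ.isHermitian, Finset.sum_mul, mul_assoc]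
  rw [hlim]
  refine tendsto_finsetSum _ fun j _ => tendsto_finsetSum _ fun i _ => ?_
  have hnn : ∀ i, 0 ≤ overlap hρ.isHermitian hσ.isHermitian j i * hρ.isHermitian.eigenvalues i :=
    fun i => mul_nonneg (overlap_nonneg _ _ _ _) (hρ.eigenvalues_nonneg i)
  rcases (hσ.eigenvalues_nonneg j).eq_or_lt with hj | hj
  -- On the kernel of `σ`, `c ρ ≤ σ` forces `ρ` to have no weight, so the divergent logarithm has
  -- coefficient zero.
  · have h0 : overlap hρ.isHermitian hσ.isHermitian j i * hρ.isHermitian.eigenvalues i = 0 := by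
      have h1 := eigenWeight_nonneg hσ.isHermitian h j
      rw [eigenWeight_sub, eigenWeight_smul, eigenWeight_self, ← hj,
        ← sum_overlap_mul hρ.isHermitian] at h1
      have h2 := Finset.single_le_sum (fun i _ => hnn i) (Finset.mem_univ i)
      have h3 := Finset.sum_nonneg fun i (_ : i ∈ Finset.univ) => hnn i
      nlinarith [hnn i]
    simp only [← mul_assoc, h0, zero_mul]
    exact tendsto_const_nhds
  · refine Tendsto.const_mul _ (Tendsto.const_mul _ ?_)
    refine Tendsto.mono_left ?_ nhdsWithin_le_nhds
    have : ContinuousAt (fun s => Real.log (hσ.isHermitian.eigenvalues j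
        + s * hρ.isHermitian.eigenvalues i)) 0 :=
      ContinuousAt.log (by fun_prop) (by simpa using hj.ne')
    simpa [ContinuousAt] using this

/-- For an eigenvalue `l > 0` of `ρ` and `m` of `σ`, `log (m + s l) - log s = log (m / s + l)` tends
to `log l`: `σ` disappears. -/
theorem tendsto_resolventPrimitive_atTop {ρ σ : Matrix S S ℂ} (hρ : ρ.PosSemidef)
    (hσ : σ.PosSemidef) :
    Tendsto (fun s => resolventPrimitive hρ.isHermitian hσ.isHermitian s
        - ρ.trace.re * Real.log s) atTop
      (𝓝 (-∑ i, Real.negMulLog (hρ.isHermitian.eigenvalues i))) := by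
  have htr : ρ.trace.re = ∑ j, ∑ i, overlap hρ.isHermitian hσ.isHermitian j i
      * hρ.isHermitian.eigenvalues i := by
    rw [Finset.sum_comm]
    simp only [← Finset.sum_mul, sum_overlap, one_mul]
    rw [hρ.isHermitian.trace_eq_sum_eigenvalues]
    simp
  have hlim : -∑ i, Real.negMulLog (hρ.isHermitian.eigenvalues i)
      = ∑ j, ∑ i, overlap hρ.isHermitian hσ.isHermitian j i
        * (hρ.isHermitian.eigenvalues i * Real.log (hρ.isHermitian.eigenvalues i)) := by
    rw [Finset.sum_comm]
    simp only [← Finset.sum_mul, sum_overlap, one_mul]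
    simp [Real.negMulLog]
  rw [hlim]
  simp only [resolventPrimitive, htr, Finset.sum_mul, ← Finset.sum_sub_distrib]
  refine tendsto_finsetSum _ fun j _ => tendsto_finsetSum _ fun i _ => ?_
  simp only [mul_assoc, ← mul_sub]
  refine Tendsto.const_mul _ ?_
  rcases (hρ.eigenvalues_nonneg i).eq_or_lt with h | h
  · simp [← h]
  · refine Tendsto.const_mul _ ?_
    have h1 : Tendsto (fun s => Real.log (hσ.isHermitian.eigenvalues j / s
        + hρ.isHermitian.eigenvalues i)) atTop (𝓝 (Real.log (hρ.isHermitian.eigenvalues i))) := by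
      have h2 : Tendsto (fun s => hσ.isHermitian.eigenvalues j / s
        + hρ.isHermitian.eigenvalues i) atTop (𝓝 (0 + hρ.isHermitian.eigenvalues i)) :=
        (tendsto_const_nhds.div_atTop tendsto_id).add_const _
      rw [zero_add] at h2
      exact h2.log h.ne'
    refine h1.congr' ?_
    filter_upwards [eventually_gt_atTop 0] with s hs
    have hj := hσ.eigenvalues_nonneg j
    rw [← Real.log_div (by positivity) hs.ne', add_div, mul_div_cancel_left₀ _ hs.ne']

variable {k : ℕ} {K : Fin k → Matrix T S ℂ}

/-- Monotonicity of the quantum relative entropy under a channel. -/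
theorem relativeEntropy_mono (hK : ∑ l, (K l)ᴴ * K l = 1) {ρ σ : Matrix S S ℂ}
    (hρ : ρ.PosSemidef) (hσ : σ.PosSemidef)
    (hρ' : (∑ l, K l * ρ * (K l)ᴴ).PosSemidef) (hσ' : (∑ l, K l * σ * (K l)ᴴ).PosSemidef)
    {c : ℝ} (hc : 0 < c) (h : (σ - (c : ℂ) • ρ).PosSemidef)
    (h' : ((∑ l, K l * σ * (K l)ᴴ) - (c : ℂ) • ∑ l, K l * ρ * (K l)ᴴ).PosSemidef) :
    -∑ i, Real.negMulLog (hρ'.isHermitian.eigenvalues i)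
        - traceMulLog hσ'.isHermitian (∑ l, K l * ρ * (K l)ᴴ)
      ≤ -∑ i, Real.negMulLog (hρ.isHermitian.eigenvalues i) - traceMulLog hσ.isHermitian ρ := by
  -- `G` increases on `(0, ∞)`; comparing its limits at `0` and `∞` is the claim. Trace preservation
  -- cancels the `log s` divergences.
  set G : ℝ → ℝ := fun s => resolventPrimitive hρ.isHermitian hσ.isHermitian s
    - resolventPrimitive hρ'.isHermitian hσ'.isHermitian s with hG
  have hderiv : ∀ s ∈ Set.Ioi (0 : ℝ), HasDerivAt G _ s := fun s hs =>
    (hasDerivAt_resolventPrimitive hρ hσ hs).sub (hasDerivAt_resolventPrimitive hρ' hσ' hs)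
  have hmono : MonotoneOn G (Set.Ioi 0) := by
    refine monotoneOn_of_deriv_nonneg (convex_Ioi 0)
      (fun s hs => (hderiv s hs).continuousAt.continuousWithinAt) ?_ ?_
    · rw [interior_Ioi]
      exact fun s hs => (hderiv s hs).differentiableAt.differentiableWithinAt
    · rw [interior_Ioi]
      intro s hs
      rw [(hderiv s hs).deriv]
      exact sub_nonneg.2 (resolventValue_mono hK hρ hσ hρ' hσ' hs)
  have htr : (∑ l, K l * ρ * (K l)ᴴ).trace = ρ.trace := by
    simp only [trace_sum, trace_mul_cycle _ ρ]
    rw [← trace_sum, ← Matrix.sum_mul, hK, one_mul]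
  have hzero := (tendsto_resolventPrimitive_zero hρ hσ hc h).sub
    (tendsto_resolventPrimitive_zero hρ' hσ' hc h')
  have htop := (tendsto_resolventPrimitive_atTop hρ hσ).sub
    (tendsto_resolventPrimitive_atTop hρ' hσ')
  simp only [htr, sub_sub_sub_cancel_right] at htop
  have hle : ∀ t, 0 < t → traceMulLog hσ.isHermitian ρ
      - traceMulLog hσ'.isHermitian (∑ l, K l * ρ * (K l)ᴴ) ≤ G t := by
    intro t ht
    refine le_of_tendsto hzero ?_
    filter_upwards [Ioo_mem_nhdsGT ht] with s hs
    exact hmono hs.1 ht hs.2.le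
  have hfin := ge_of_tendsto htop ((eventually_gt_atTop 0).mono hle)
  linarith

theorem entropy_mul_log_two {ρ : Matrix S S ℂ} (hρ : ρ.IsHermitian) :
    entropy ρ * Real.log 2 = ∑ i, Real.negMulLog (hρ.eigenvalues i) := by
  rw [entropy_eq_sum_eigenvalues hρ, Finset.sum_mul]
  refine Finset.sum_congr rfl fun i _ => ?_
  rw [entropyTerm, div_mul_cancel₀]
  exact (Real.log_pos one_lt_two).ne'

theorem sum_traceMulLog {σ : Matrix S S ℂ} (hσ : σ.IsHermitian) {ι : Type*} [Fintype ι]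
    {p : ι → ℝ} {ρ : ι → Matrix S S ℂ} (h : ∑ i, (p i : ℂ) • ρ i = σ) :
    ∑ i, p i * traceMulLog hσ (ρ i) = -(entropy σ * Real.log 2) := by
  have h1 : ∀ j, ∑ i, p i * eigenWeight hσ (ρ i) j = hσ.eigenvalues j := fun j => by
    have h2 := eigenWeight_sum hσ (fun i => (p i : ℂ) • ρ i) j
    rw [h, eigenWeight_self] at h2
    simp only [h2, eigenWeight_smul]
  rw [entropy_mul_log_two hσ, ← Finset.sum_neg_distrib]
  simp only [traceMulLog, Finset.mul_sum]
  rw [Finset.sum_comm]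
  simp only [← mul_assoc, ← Finset.sum_mul, h1, Real.negMulLog, neg_mul, neg_neg]

theorem IsQuantumChannel.posSemidef {D : Matrix S S ℂ →ₗ[ℂ] Matrix T T ℂ}
    (hD : IsQuantumChannel D) {ρ : Matrix S S ℂ} (hρ : ρ.PosSemidef) : (D ρ).PosSemidef := by
  obtain ⟨k, K, hK, hDK⟩ := hD
  rw [hDK]
  exact posSemidef_sum _ fun l _ => hρ.mul_mul_conjTranspose_same _

/-- Monotonicity of the Holevo quantity under a channel. -/
theorem holevo_mono {D : Matrix S S ℂ →ₗ[ℂ] Matrix T T ℂ}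
    (hD : IsQuantumChannel D) {ι : Type*} [Fintype ι] {p : ι → ℝ} (hp : ∀ i, 0 ≤ p i)
    {ρ : ι → Matrix S S ℂ} (hρ : ∀ i, (ρ i).PosSemidef) :
    entropy (∑ i, (p i : ℂ) • D (ρ i)) - ∑ i, p i * entropy (D (ρ i))
      ≤ entropy (∑ i, (p i : ℂ) • ρ i) - ∑ i, p i * entropy (ρ i) := by
  classical
  set σ := ∑ i, (p i : ℂ) • ρ i with hσdef
  have hterm : ∀ i, ((p i : ℂ) • ρ i).PosSemidef := fun i =>
    (hρ i).smul (by exact_mod_cast hp i)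
  have hσ : σ.PosSemidef := posSemidef_sum _ fun i _ => hterm i
  have hDσ : ∑ i, (p i : ℂ) • D (ρ i) = D σ := by simp [hσdef]
  have hσ' := hD.posSemidef hσ
  rw [hDσ]
  have hi : ∀ i, p i * (-(entropy (D (ρ i)) * Real.log 2)
        - traceMulLog hσ'.isHermitian (D (ρ i)))
      ≤ p i * (-(entropy (ρ i) * Real.log 2) - traceMulLog hσ.isHermitian (ρ i)) := by
    intro i
    rcases (hp i).eq_or_lt with h0 | hpos
    · simp [← h0]
    · refine mul_le_mul_of_nonneg_left ?_ hpos.le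
      -- The weight `p i` itself serves as the domination constant, since the other terms of the
      -- mixture are positive.
      have hdom : (σ - (p i : ℂ) • ρ i).PosSemidef := by
        rw [hσdef, ← Finset.sum_erase_eq_sub (Finset.mem_univ i)]
        exact posSemidef_sum _ fun i _ => hterm i
      have hdom' := hD.posSemidef hdom
      rw [map_sub, map_smul] at hdom'
      have hρ' := hD.posSemidef (hρ i)
      rw [entropy_mul_log_two (hρ i).isHermitian, entropy_mul_log_two hρ'.isHermitian]
      obtain ⟨k, K, hK, hDK⟩ := hD
      have key := relativeEntropy_mono hK (hρ i) hσ (by rw [← hDK]; exact hρ')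
        (by rw [← hDK]; exact hσ') hpos hdom (by rw [← hDK, ← hDK]; exact hdom')
      simpa only [← hDK] using key
  have hsum := Finset.sum_le_sum fun i (_ : i ∈ Finset.univ) => hi i
  simp only [mul_sub, Finset.sum_sub_distrib, sum_traceMulLog hσ.isHermitian hσdef.symm,
    sum_traceMulLog hσ'.isHermitian hDσ, mul_neg, Finset.sum_neg_distrib, ← mul_assoc,
    ← Finset.sum_mul] at hsum
  have hlog := Real.log_pos one_lt_two
  nlinarith

end RelativeEntropy

/-! ### Carathéodory's theorem and compactness of convex hulls. -/

section ConvexHull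

variable {E : Type*} [AddCommGroup E] [Module ℝ E] [FiniteDimensional ℝ E]

/-- Carathéodory's theorem with a fixed number of points. -/
theorem mem_convexHull_iff_exists_fin {s : Set E} {z : E} :
    z ∈ convexHull ℝ s ↔ ∃ (w : Fin (Module.finrank ℝ E + 1) → ℝ)
      (v : Fin (Module.finrank ℝ E + 1) → E),
      w ∈ stdSimplex ℝ (Fin (Module.finrank ℝ E + 1)) ∧ (∀ i, v i ∈ s) ∧ ∑ i, w i • v i = z := by
  constructor
  · intro hz
    obtain ⟨ι, _, y, w, hys, hy, hw, hw1, hsum⟩ := eq_pos_convex_span_of_mem_convexHull hz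
    have hcard : Fintype.card ι ≤ Fintype.card (Fin (Module.finrank ℝ E + 1)) := by
      rw [Fintype.card_fin]
      exact hy.card_le_finrank_succ.trans
        (Nat.succ_le_succ (Submodule.finrank_le _))
    obtain ⟨f⟩ := Function.Embedding.nonempty_of_card_le hcard
    obtain ⟨z₀, hz₀⟩ := convexHull_nonempty_iff.1 ⟨z, hz⟩
    -- Unused indices get weight zero and the dummy point `z₀`, which must still lie in `s`.
    refine ⟨Function.extend f w 0, Function.extend f y fun _ => z₀, ⟨fun i => ?_, ?_⟩,
      fun i => ?_, ?_⟩
    · by_cases hi : ∃ j, f j = i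
      · obtain ⟨j, rfl⟩ := hi
        rw [f.injective.extend_apply]
        exact (hw j).le
      · rw [Function.extend_apply' _ _ _ hi]
        rfl
    · exact (Fintype.sum_of_injective f f.injective w (Function.extend f w 0)
        (fun i hi => Function.extend_apply' _ _ _ hi)
        fun j => (f.injective.extend_apply _ _ _).symm).symm.trans hw1
    · by_cases hi : ∃ j, f j = i
      · obtain ⟨j, rfl⟩ := hi
        rw [f.injective.extend_apply]
        exact hys ⟨j, rfl⟩
      · rw [Function.extend_apply' _ _ _ hi]
        exact hz₀
    · rw [← hsum]
      refine (Fintype.sum_of_injective f f.injective _ _ (fun i hi => ?_)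
        fun j => ?_).symm
      · rw [Function.extend_apply' w _ _ hi, Pi.zero_apply, zero_smul]
      · rw [f.injective.extend_apply, f.injective.extend_apply]
  · rintro ⟨w, v, hw, hv, rfl⟩
    exact (convex_convexHull ℝ s).sum_mem (fun i _ => hw.1 i) hw.2
      fun i _ => subset_convexHull ℝ s (hv i)

theorem isCompact_convexHull_of_finiteDimensional [TopologicalSpace E] [ContinuousAdd E]
    [ContinuousSMul ℝ E] {s : Set E} (hs : IsCompact s) : IsCompact (convexHull ℝ s) := by
  have h : convexHull ℝ s = (fun a : (Fin (Module.finrank ℝ E + 1) → ℝ)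
      × (Fin (Module.finrank ℝ E + 1) → E) => ∑ i, a.1 i • a.2 i) ''
        (stdSimplex ℝ (Fin (Module.finrank ℝ E + 1)) ×ˢ Set.univ.pi fun _ => s) := by
    ext z
    rw [mem_convexHull_iff_exists_fin]
    constructor
    · rintro ⟨w, v, hw, hv, rfl⟩
      exact ⟨(w, v), ⟨hw, fun i _ => hv i⟩, rfl⟩
    · rintro ⟨⟨w, v⟩, ⟨hw, hv⟩, rfl⟩
      exact ⟨w, v, hw, fun i => hv i trivial, rfl⟩
  rw [h]
  exact ((isCompact_stdSimplex ℝ _).prod (isCompact_univ_pi fun _ => hs)).image (by fun_prop)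

end ConvexHull

/-! ### Compactness of the state space and continuity of entropy. -/

section Densities

variable {A B E : Type*} [Fintype A] [DecidableEq A]
  [Fintype B] [DecidableEq B] [Fintype E] [DecidableEq E]

theorem convex_isDensity : Convex ℝ {ρ : Matrix A A ℂ | IsDensity ρ} := by
  intro ρ hρ σ hσ a b ha hb hab
  refine ⟨(hρ.1.smul ha).add (hσ.1.smul hb), ?_⟩
  rw [trace_add, trace_smul, trace_smul, hρ.2, hσ.2, ← add_smul, hab, one_smul]

theorem isCompact_isUnitVector : IsCompact {v : A → ℂ | IsUnitVector v} := by
  refine Metric.isCompact_of_isClosed_isBounded ?_ ?_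
  · exact isClosed_eq (by fun_prop) continuous_const
  · refine (Metric.isBounded_closedBall (x := (0 : A → ℂ)) (r := 1)).subset fun v hv => ?_
    rw [mem_closedBall_zero_iff, pi_norm_le_iff_of_nonneg zero_le_one]
    intro a
    have h := Finset.single_le_sum (fun a _ => sq_nonneg ‖v a‖) (Finset.mem_univ a)
    have hv' : ∑ a, ‖v a‖ ^ 2 = 1 := hv
    rw [hv'] at h
    exact (sq_le_one_iff₀ (norm_nonneg _)).1 h

/-- By purification, the state space is a continuous image of the unit sphere of `A ⊗ A`. -/
theorem isCompact_isDensity : IsCompact {ρ : Matrix A A ℂ | IsDensity ρ} := by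
  have h : {ρ : Matrix A A ℂ | IsDensity ρ}
      = reducedState '' {φ : A × A → ℂ | IsUnitVector φ} := by
    ext ρ
    constructor
    · intro hρ
      exact exists_isUnitVector_reducedState hρ (Equiv.refl A)
    · rintro ⟨φ, hφ, rfl⟩
      exact isDensity_reducedState hφ
  rw [h]
  refine isCompact_isUnitVector.image ?_
  refine continuous_pi fun i => continuous_pi fun j => ?_
  simp only [reducedState, partialTrace, ketbra, vecMulVec_apply, of_apply, Pi.star_apply]
  fun_prop

theorem IsDensity.sum_eigenvalues {ρ : Matrix A A ℂ} (hρ : IsDensity ρ) :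
    ∑ i, hρ.isHermitian.eigenvalues i = 1 := by
  have h := hρ.isHermitian.trace_eq_sum_eigenvalues
  rw [hρ.2] at h
  simpa using congrArg Complex.re h.symm

theorem IsDensity.eigenvalues_le_one {ρ : Matrix A A ℂ} (hρ : IsDensity ρ) (i : A) :
    hρ.isHermitian.eigenvalues i ≤ 1 :=
  (Finset.single_le_sum (fun i _ => hρ.1.eigenvalues_nonneg i) (Finset.mem_univ i)).trans_eq
    hρ.sum_eigenvalues

theorem entropy_eq_trace_cfc {ρ : Matrix A A ℂ} (hρ : ρ.IsHermitian) :
    entropy ρ = (cfc entropyTerm ρ).trace.re := by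
  rw [entropy_eq_sum_eigenvalues hρ, hρ.cfc_eq, Matrix.IsHermitian.cfc,
    Unitary.conjStarAlgAut_apply, trace_mul_cycle, Unitary.coe_star_mul_self, one_mul,
    trace_diagonal, Complex.re_sum]
  rfl

-- All spectra lie in the fixed compact set `[0, 1]`, where the continuous functional calculus of
-- `-x log₂ x` varies continuously with the matrix.
open scoped Matrix.Norms.L2Operator in
theorem continuousOn_entropy :
    ContinuousOn (entropy : Matrix A A ℂ → ℝ) {ρ | IsDensity ρ} := by
  have h : ContinuousOn (cfc entropyTerm : Matrix A A ℂ → Matrix A A ℂ)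
      {a | IsSelfAdjoint a ∧ spectrum ℝ a ⊆ Set.Icc 0 1} :=
    continuousOn_cfc (Matrix A A ℂ) isCompact_Icc entropyTerm continuous_entropyTerm.continuousOn
  have h1 : ContinuousOn (cfc entropyTerm : Matrix A A ℂ → Matrix A A ℂ) {ρ | IsDensity ρ} := by
    refine h.mono fun ρ hρ => ⟨hρ.isHermitian, ?_⟩
    rw [hρ.isHermitian.spectrum_real_eq_range_eigenvalues]
    rintro _ ⟨i, rfl⟩
    exact ⟨hρ.1.eigenvalues_nonneg i, hρ.eigenvalues_le_one i⟩
  have h2 : Continuous fun M : Matrix A A ℂ => M.trace.re :=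
    Complex.continuous_re.comp (continuous_id.matrix_trace)
  exact (h2.comp_continuousOn h1).congr fun ρ hρ => entropy_eq_trace_cfc hρ.isHermitian

theorem exists_pure_decomposition {ρ : Matrix A A ℂ} (hρ : IsDensity ρ) :
    ∃ (p : A → ℝ) (v : A → A → ℂ), p ∈ stdSimplex ℝ A ∧ (∀ i, IsUnitVector (v i)) ∧
      ∑ i, (p i : ℂ) • ketbra (v i) = ρ := by
  have hU := conjTranspose_eigenvectorUnitary_mul hρ.isHermitian
  have eρ := spectral_eq hρ.isHermitian
  refine ⟨hρ.isHermitian.eigenvalues, fun i a =>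
    (hρ.isHermitian.eigenvectorUnitary : Matrix A A ℂ) a i,
    ⟨hρ.1.eigenvalues_nonneg, hρ.sum_eigenvalues⟩, fun i => ?_, ?_⟩
  · have h := congrFun (congrFun hU i) i
    rw [mul_apply, one_apply_eq] at h
    simp only [conjTranspose_apply, Complex.star_def, ← Complex.normSq_eq_conj_mul_self,
      Complex.normSq_eq_norm_sq] at h
    exact_mod_cast h
  · conv_rhs => rw [eρ]
    ext a b
    rw [mul_apply, Matrix.sum_apply]
    refine Finset.sum_congr rfl fun i _ => ?_
    simp only [mul_diagonal, conjTranspose_apply, Matrix.smul_apply, ketbra, vecMulVec_apply,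
      Pi.star_apply, smul_eq_mul]
    ring

theorem exists_isDensity [Nonempty A] : ∃ ρ : Matrix A A ℂ, IsDensity ρ := by
  obtain ⟨a⟩ := ‹Nonempty A›
  exact ⟨ketbra (Pi.single a 1),
    isDensity_ketbra (by simp [IsUnitVector, Pi.single_apply, apply_ite])⟩

end Densities

/-! ### Nonnegative coherent information for degradable channels. -/

section CoherentInformation

variable {A B E : Type*} [Fintype A] [DecidableEq A]
  [Fintype B] [DecidableEq B] [Fintype E] [DecidableEq E]
  {N : Matrix A A ℂ →ₗ[ℂ] Matrix B B ℂ} {V : Matrix (B × E) A ℂ}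

/-- Both sides equal the entropy of `id ⊗ N` on a purification, which does not involve the
extension. -/
theorem IsIsometricExtension.entropy_complementary_eq {F : Type*} [Fintype F] [DecidableEq F]
    {V' : Matrix (B × F) A ℂ} (hV : IsIsometricExtension N V) (hV' : IsIsometricExtension N V')
    {ρ : Matrix A A ℂ} (hρ : IsDensity ρ) :
    entropy (complementary V ρ) = entropy (complementary V' ρ) := by
  obtain ⟨φ, -, rfl⟩ := exists_isUnitVector_reducedState hρ (Equiv.refl A)
  rw [← hV.entropy_idTensor, ← hV'.entropy_idTensor]

/-- The coherent information of a degradable channel is nonnegative. -/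
theorem IsDegradable.entropy_complementary_le (hN : IsDegradable N)
    (hV : IsIsometricExtension N V) {ρ : Matrix A A ℂ} (hρ : IsDensity ρ) :
    entropy (complementary V ρ) ≤ entropy (N ρ) := by
  obtain ⟨d, V', D, hV', hD, hDN⟩ := hN
  rw [hV.entropy_complementary_eq hV' hρ]
  obtain ⟨p, v, hp, hv, hsum⟩ := exists_pure_decomposition hρ
  have hψ := fun i => isDensity_ketbra (hv i)
  have h := holevo_mono hD hp.1 fun i => (hV.isDensity (hψ i)).1
  -- On pure inputs the entropies at `B` and at the environment agree, so the averaged terms of the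
  -- two Holevo quantities cancel.
  simp only [hDN _ (hψ _), hV'.entropy_complementary_ketbra] at h
  simp only [← hDN _ (hψ _), ← map_smul, ← map_sum, hsum, hDN _ hρ] at h
  linarith

end CoherentInformation

/-! ### The value sets as images of convex hulls, and their comparison. -/

section TradeoffFormulas

variable {A B E : Type*} [Fintype A] [DecidableEq A]
  [Fintype B] [DecidableEq B] [Fintype E] [DecidableEq E]

/-- The graph of `g` over the density operators. -/
def densityGraph (g : Matrix A A ℂ → ℝ) : Set (Matrix A A ℂ × ℝ) :=
  (fun ρ => (ρ, g ρ)) '' {ρ | IsDensity ρ}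

theorem fst_mem_of_mem_convexHull {s : Set (Matrix A A ℂ × ℝ)} (hs : ∀ z ∈ s, IsDensity z.1)
    {z : Matrix A A ℂ × ℝ} (hz : z ∈ convexHull ℝ s) : IsDensity z.1 := by
  have h : convexHull ℝ s ⊆ Prod.fst ⁻¹' {ρ : Matrix A A ℂ | IsDensity ρ} :=
    convexHull_min hs (convex_isDensity.linear_preimage (LinearMap.fst ℝ (Matrix A A ℂ) ℝ))
  exact h hz

theorem isDensity_of_mem_densityGraph (g : Matrix A A ℂ → ℝ) :
    ∀ z ∈ densityGraph g, IsDensity z.1 := by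
  rintro _ ⟨ρ, hρ, rfl⟩
  exact hρ

theorem isCompact_densityGraph {g : Matrix A A ℂ → ℝ} (hg : ContinuousOn g {ρ | IsDensity ρ}) :
    IsCompact (densityGraph g) :=
  isCompact_isDensity.image_of_continuousOn (continuousOn_id.prodMk hg)

theorem mem_convexHull_densityGraph {ι : Type*} [Fintype ι] {g : Matrix A A ℂ → ℝ} {p : ι → ℝ}
    (hp : p ∈ stdSimplex ℝ ι) {ρ : ι → Matrix A A ℂ} (hρ : ∀ i, IsDensity (ρ i)) :
    (∑ i, (p i : ℂ) • ρ i, ∑ i, p i * g (ρ i)) ∈ convexHull ℝ (densityGraph g) := by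
  have h := (convex_convexHull ℝ (densityGraph g)).sum_mem (t := Finset.univ)
    (fun i _ => hp.1 i) hp.2 fun i _ => subset_convexHull ℝ _ ⟨ρ i, hρ i, rfl⟩
  convert h
  · rw [Prod.fst_sum]
    rfl
  · rw [Prod.snd_sum]
    rfl

theorem exists_of_mem_convexHull_densityGraph {g : Matrix A A ℂ → ℝ} {z : Matrix A A ℂ × ℝ}
    (hz : z ∈ convexHull ℝ (densityGraph g)) :
    ∃ (p : Fin (Module.finrank ℝ (Matrix A A ℂ × ℝ) + 1) → ℝ)
      (ρ : Fin (Module.finrank ℝ (Matrix A A ℂ × ℝ) + 1) → Matrix A A ℂ),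
      p ∈ stdSimplex ℝ _ ∧ (∀ i, IsDensity (ρ i)) ∧
        z = (∑ i, (p i : ℂ) • ρ i, ∑ i, p i * g (ρ i)) := by
  obtain ⟨p, v, hp, hv, rfl⟩ := mem_convexHull_iff_exists_fin.1 hz
  choose ρ hρ hv using hv
  refine ⟨p, ρ, hp, hρ, ?_⟩
  rw [Prod.ext_iff, Prod.fst_sum, Prod.snd_sum]
  simp only [← hv]
  exact ⟨rfl, rfl⟩

/-- The integrand `μ H(N ρ) - (1 + μ) H(Nᶜ ρ)` of the classical-quantum trade-off formula. -/
def cqTerm (μ : ℝ) (N : Matrix A A ℂ →ₗ[ℂ] Matrix B B ℂ) (V : Matrix (B × E) A ℂ)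
    (ρ : Matrix A A ℂ) : ℝ :=
  μ * entropy (N ρ) - (1 + μ) * entropy (complementary V ρ)

/-- The coherent information `H(N ρ) - H(Nᶜ ρ)` of the channel. -/
def channelCoherentInfo (N : Matrix A A ℂ →ₗ[ℂ] Matrix B B ℂ) (V : Matrix (B × E) A ℂ)
    (ρ : Matrix A A ℂ) : ℝ :=
  entropy (N ρ) - entropy (complementary V ρ)

/-- Joint range of an averaged input state and the corresponding summand of the public-private
trade-off formula. -/
def ppGraph (μ : ℝ) (N : Matrix A A ℂ →ₗ[ℂ] Matrix B B ℂ) (V : Matrix (B × E) A ℂ) :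
    Set (Matrix A A ℂ × ℝ) :=
  (fun z => (z.1, cqTerm μ N V z.1 - (1 + μ) * z.2)) ''
    convexHull ℝ (densityGraph (channelCoherentInfo N V))

theorem isDensity_of_mem_ppGraph (μ : ℝ) (N : Matrix A A ℂ →ₗ[ℂ] Matrix B B ℂ)
    (V : Matrix (B × E) A ℂ) : ∀ z ∈ ppGraph μ N V, IsDensity z.1 := by
  rintro _ ⟨z, hz, rfl⟩
  exact (fst_mem_of_mem_convexHull (isDensity_of_mem_densityGraph _) hz : IsDensity z.1)

/-- The objective `H(N ρ) + t`. -/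
def outputObjective (N : Matrix A A ℂ →ₗ[ℂ] Matrix B B ℂ) (z : Matrix A A ℂ × ℝ) : ℝ :=
  entropy (N z.1) + z.2

variable {N : Matrix A A ℂ →ₗ[ℂ] Matrix B B ℂ} {V : Matrix (B × E) A ℂ}

theorem IsIsometricExtension.continuousOn_entropy_output (hV : IsIsometricExtension N V) :
    ContinuousOn (fun ρ => entropy (N ρ)) {ρ | IsDensity ρ} :=
  continuousOn_entropy.comp (N.continuous_of_finiteDimensional).continuousOn
    fun _ hρ => hV.isDensity hρ

theorem continuousOn_entropy_complementary (hV : Vᴴ * V = 1) :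
    ContinuousOn (fun ρ => entropy (complementary V ρ)) {ρ | IsDensity ρ} :=
  continuousOn_entropy.comp (complementaryMap V).continuous_of_finiteDimensional.continuousOn
    fun _ hρ => isDensity_complementary hV hρ

theorem IsIsometricExtension.continuousOn_cqTerm (hV : IsIsometricExtension N V) (μ : ℝ) :
    ContinuousOn (cqTerm μ N V) {ρ | IsDensity ρ} :=
  (continuousOn_const.mul hV.continuousOn_entropy_output).sub
    (continuousOn_const.mul (continuousOn_entropy_complementary hV.1))

theorem IsIsometricExtension.continuousOn_channelCoherentInfo (hV : IsIsometricExtension N V) :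
    ContinuousOn (channelCoherentInfo N V) {ρ | IsDensity ρ} :=
  hV.continuousOn_entropy_output.sub (continuousOn_entropy_complementary hV.1)

theorem IsIsometricExtension.isCompact_ppGraph (hV : IsIsometricExtension N V) (μ : ℝ) :
    IsCompact (ppGraph μ N V) := by
  refine (isCompact_convexHull_of_finiteDimensional
    (isCompact_densityGraph hV.continuousOn_channelCoherentInfo)).image_of_continuousOn ?_
  refine continuousOn_fst.prodMk (ContinuousOn.sub ?_ (by fun_prop))
  exact (hV.continuousOn_cqTerm μ).comp continuousOn_fst fun z hz =>
    fst_mem_of_mem_convexHull (isDensity_of_mem_densityGraph _) hz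

theorem IsIsometricExtension.isCompact_image_outputObjective (hV : IsIsometricExtension N V)
    {s : Set (Matrix A A ℂ × ℝ)} (hs : IsCompact s) (hd : ∀ z ∈ s, IsDensity z.1) :
    IsCompact (outputObjective N '' convexHull ℝ s) := by
  refine (isCompact_convexHull_of_finiteDimensional hs).image_of_continuousOn ?_
  exact (hV.continuousOn_entropy_output.comp continuousOn_fst fun z hz =>
    fst_mem_of_mem_convexHull hd hz).add continuousOn_snd

theorem IsIsometricExtension.cqValues_eq (hV : IsIsometricExtension N V) (μ : ℝ) :
    cqValues μ N = outputObjective N '' convexHull ℝ (densityGraph (cqTerm μ N V)) := by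
  ext r
  constructor
  · rintro ⟨m, d, p, φ, hp, hφ, rfl⟩
    rw [hV.cqObjective_cqState μ p hφ]
    exact ⟨_, mem_convexHull_densityGraph hp fun x => isDensity_reducedState (hφ x), rfl⟩
  · rintro ⟨z, hz, rfl⟩
    obtain ⟨p, ρ, hp, hρ, rfl⟩ := exists_of_mem_convexHull_densityGraph hz
    choose φ hφ hφρ using fun i => exists_isUnitVector_reducedState (hρ i) (Fintype.equivFin A).symm
    refine ⟨_, _, p, φ, hp, hφ, ?_⟩
    rw [hV.cqObjective_cqState μ p hφ]
    simp only [hφρ]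
    rfl

theorem exists_conditional {X Y : Type*} [Fintype X] [Fintype Y] {p : X × Y → ℝ}
    (hp : p ∈ stdSimplex ℝ (X × Y)) :
    ∃ (w : X → ℝ) (q : X → Y → ℝ), w ∈ stdSimplex ℝ X ∧ (∀ x, q x ∈ stdSimplex ℝ Y) ∧
      p = fun z => w z.1 * q z.1 z.2 := by
  classical
  have hne : Nonempty (X × Y) := by
    by_contra h
    rw [not_nonempty_iff] at h
    simpa using hp.2
  obtain ⟨-, y₀⟩ := hne
  have hnn : ∀ x, 0 ≤ ∑ y, p (x, y) := fun x => Finset.sum_nonneg fun y _ => hp.1 _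
  refine ⟨fun x => ∑ y, p (x, y),
    -- Where the marginal vanishes any distribution would do; a point mass is chosen.
    fun x => if ∑ y, p (x, y) = 0 then Pi.single y₀ 1 else fun y => p (x, y) / ∑ y, p (x, y),
    ⟨hnn, by rw [← Fintype.sum_prod_type]; exact hp.2⟩, fun x => ?_, ?_⟩
  · dsimp only
    split_ifs with h
    · exact single_mem_stdSimplex ℝ y₀
    · exact ⟨fun y => div_nonneg (hp.1 _) (hnn x), by rw [← Finset.sum_div, div_self h]⟩
  · ext ⟨x, y⟩
    dsimp only
    split_ifs with h
    · rw [h, zero_mul]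
      exact (Finset.sum_eq_zero_iff_of_nonneg fun y _ => hp.1 _).1 h y (Finset.mem_univ y)
    · rw [mul_div_cancel₀ _ h]

/-- The inner hull in `ppGraph` averages over `Y` given `x`, the outer one over `X`. Carathéodory
with a fixed number of points yields one alphabet `Y` serving every `x`. -/
theorem IsIsometricExtension.ppValues_eq (hV : IsIsometricExtension N V) (μ : ℝ) :
    ppValues μ V = outputObjective N '' convexHull ℝ (ppGraph μ N V) := by
  ext r
  constructor
  · rintro ⟨m, n, p, ρ, hp, hρ, rfl⟩
    obtain ⟨w, q, hw, hq, rfl⟩ := exists_conditional hp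
    rw [hV.ppObjective_ppState μ w hq hρ]
    have h := (convex_convexHull ℝ (ppGraph μ N V)).sum_mem (t := Finset.univ)
      (fun x _ => hw.1 x) hw.2 fun x _ => subset_convexHull ℝ _ ⟨_, mem_convexHull_densityGraph
        (g := channelCoherentInfo N V) (hq x) (hρ x), rfl⟩
    refine ⟨_, h, ?_⟩
    rw [outputObjective, Prod.fst_sum, Prod.snd_sum]
    rfl
  · rintro ⟨z, hz, rfl⟩
    obtain ⟨w, v, hw, hv, rfl⟩ := mem_convexHull_iff_exists_fin.1 hz
    choose u hu huv using hv
    choose q ρ hq hρ hu using fun x => exists_of_mem_convexHull_densityGraph (hu x)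
    refine ⟨_, _, fun z => w z.1 * q z.1 z.2, ρ, ⟨fun z => mul_nonneg (hw.1 _) ((hq _).1 _), ?_⟩,
      hρ, ?_⟩
    · rw [Fintype.sum_prod_type]
      simp only [← Finset.mul_sum, (hq _).2, mul_one]
      exact hw.2
    · rw [hV.ppObjective_ppState μ w hq hρ, outputObjective, Prod.fst_sum, Prod.snd_sum]
      simp only [← huv, hu]
      rfl

theorem IsIsometricExtension.densityGraph_cqTerm_subset (hV : IsIsometricExtension N V) (μ : ℝ) :
    densityGraph (cqTerm μ N V) ⊆ ppGraph μ N V := by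
  rintro _ ⟨ρ, hρ, rfl⟩
  obtain ⟨p, v, hp, hv, hsum⟩ := exists_pure_decomposition hρ
  -- Second coordinate zero: the eigenvectors of `ρ` are pure and have no coherent information.
  refine ⟨(ρ, 0), ?_, by simp⟩
  have h := mem_convexHull_densityGraph (g := channelCoherentInfo N V) hp
    fun i => isDensity_ketbra (hv i)
  rw [hsum] at h
  simpa [channelCoherentInfo, hV.entropy_complementary_ketbra] using h

theorem IsDegradable.exists_ge_of_mem_convexHull_ppGraph (hN : IsDegradable N)
    (hV : IsIsometricExtension N V) {μ : ℝ} (hμ : 0 ≤ μ) {z : Matrix A A ℂ × ℝ}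
    (hz : z ∈ convexHull ℝ (ppGraph μ N V)) :
    ∃ t, z.2 ≤ t ∧ (z.1, t) ∈ convexHull ℝ (densityGraph (cqTerm μ N V)) := by
  -- The points lying below the classical-quantum hull form a convex set, so it suffices to treat
  -- `ppGraph` itself.
  suffices h : convexHull ℝ (ppGraph μ N V)
      ⊆ {z | ∃ t, z.2 ≤ t ∧ (z.1, t) ∈ convexHull ℝ (densityGraph (cqTerm μ N V))} from h hz
  refine convexHull_min ?_ ?_
  · rintro _ ⟨z, hz, rfl⟩
    refine ⟨_, ?_, subset_convexHull ℝ _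
      ⟨z.1, fst_mem_of_mem_convexHull (isDensity_of_mem_densityGraph _) hz, rfl⟩⟩
    obtain ⟨p, ρ, hp, hρ, rfl⟩ := exists_of_mem_convexHull_densityGraph hz
    have hnn : 0 ≤ ∑ i, p i * channelCoherentInfo N V (ρ i) := Finset.sum_nonneg fun i _ =>
      mul_nonneg (hp.1 i) (sub_nonneg.2 (hN.entropy_complementary_le hV (hρ i)))
    have : 0 ≤ (1 + μ) * ∑ i, p i * channelCoherentInfo N V (ρ i) := by positivity
    dsimp only
    linarith
  · rintro z ⟨t, hzt, ht⟩ z' ⟨t', hzt', ht'⟩ a b ha hb hab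
    refine ⟨a * t + b * t', ?_, convex_convexHull ℝ _ ht ht' ha hb hab⟩
    exact add_le_add (mul_le_mul_of_nonneg_left hzt ha) (mul_le_mul_of_nonneg_left hzt' hb)

end TradeoffFormulas

end QTradeoff

end

theorem mainTheorem11 {A B E : Type*} [Fintype A] [DecidableEq A] [Nonempty A]
    [Fintype B] [DecidableEq B] [Fintype E] [DecidableEq E]
    (N : Matrix A A ℂ →ₗ[ℂ] Matrix B B ℂ) (hN : QTradeoff.IsQuantumChannel N)
    (V : Matrix (B × E) A ℂ) (hV : QTradeoff.IsIsometricExtension N V)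
    (μ : ℝ) (hμ : 0 ≤ μ) :
    IsGreatest (QTradeoff.cqValues μ N) (QTradeoff.cqFormula μ N) ∧
    IsGreatest (QTradeoff.ppValues μ V) (QTradeoff.ppFormula μ V) ∧
    QTradeoff.cqFormula μ N ≤ QTradeoff.ppFormula μ V ∧
    (QTradeoff.IsDegradable N → QTradeoff.cqFormula μ N = QTradeoff.ppFormula μ V) := by
  obtain ⟨ρ, hρ⟩ := QTradeoff.exists_isDensity (A := A)
  have hsub : QTradeoff.cqValues μ N ⊆ QTradeoff.ppValues μ V := by
    rw [hV.cqValues_eq μ, hV.ppValues_eq μ]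
    exact Set.image_mono (convexHull_mono (hV.densityGraph_cqTerm_subset μ))
  have hne : (QTradeoff.cqValues μ N).Nonempty := by
    rw [hV.cqValues_eq μ]
    exact ⟨_, _, subset_convexHull ℝ _ ⟨ρ, hρ, rfl⟩, rfl⟩
  have hcq : IsGreatest (QTradeoff.cqValues μ N) (QTradeoff.cqFormula μ N) := by
    refine IsCompact.isGreatest_sSup ?_ hne
    rw [hV.cqValues_eq μ]
    exact hV.isCompact_image_outputObjective
      (QTradeoff.isCompact_densityGraph (hV.continuousOn_cqTerm μ))
      (QTradeoff.isDensity_of_mem_densityGraph _)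
  have hpp : IsGreatest (QTradeoff.ppValues μ V) (QTradeoff.ppFormula μ V) := by
    refine IsCompact.isGreatest_sSup ?_ (hne.mono hsub)
    rw [hV.ppValues_eq μ]
    exact hV.isCompact_image_outputObjective (hV.isCompact_ppGraph μ)
      (QTradeoff.isDensity_of_mem_ppGraph μ N V)
  have hle : QTradeoff.cqFormula μ N ≤ QTradeoff.ppFormula μ V := hpp.2 (hsub hcq.1)
  refine ⟨hcq, hpp, hle, fun hdeg => le_antisymm hle ?_⟩
  have hmem := hpp.1
  rw [hV.ppValues_eq μ] at hmem
  obtain ⟨z, hz, hzeq⟩ := hmem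
  obtain ⟨t, hzt, ht⟩ := hdeg.exists_ge_of_mem_convexHull_ppGraph hV hμ hz
  rw [← hzeq]
  refine le_trans (b := QTradeoff.outputObjective N (z.1, t)) (by
    simpa [QTradeoff.outputObjective] using hzt) (hcq.2 ?_)
  rw [hV.cqValues_eq μ]
  exact ⟨_, ht, rfl⟩
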